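/- **Conventions.** A *directed graph of dimension* $d\in\mathbb N$ is a triple $G=(V,E,\lambda)$ with $V$ a finite set, $E\subseteq V\times V$ without loops, and $\lambda:V\to\{0,1\}^d$; it is *undirected* if $E$ is symmetric. It is viewed as a structure with the binary relation $E$ and the unary relations $P_i=\{v:\lambda(v)_i=1\}$, $1\le i\le d$. $\mathrm{FO}$ is first-order logic with equality over this vocabulary. $C^2$ is the two-variable logic with equality over this vocabulary, with variables $x,y$, Boolean connectives and counting quantifiers $\exists_k z\,\varphi$ ("at least $k$ nodes $z$ satisfy $\varphi$"), $k\in\mathbb N$. $\mathsf{inf}\text{-}C^2$ is the extension of $C^2$ by conjunctions and disjunctions over arbitrary sets of formulas. A *node property* assigns a truth value to every pair of a graph $G$ of dimension $d$ and a node $v$ of $G$; it is *expressible* in a logic over a class of graphs if some formula $\varphi(x)$ of the logic with exactly one free variable satisfies, for every $G$ in the class and every node $v$, that $G\models\varphi(v)$ iff the property holds at $(G,v)$. $\varphi_{\mathit{Lin}}$ is the node property accepting a node of $G$ iff $E$ is a strict linear order on $V$. For a directed graph $G=(V,E,\lambda)$, the *gadgetisation* $\mathsf{gad}(G)$ is the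 undirected graph of dimension $3$ with nodes $v^1_u$ for $u\in V$, labelled $(1,0,0)$, and $v^2_e$, $v^3_e$ for $e\in E$, labelled $(0,1,0)$ and $(0,0,1)$, and with edges $\{v^1_u,v^2_{(u,w)}\}$, $\{v^2_{(u,w)},v^3_{(u,w)}\}$, $\{v^3_{(u,w)},v^1_w\}$ for $(u,w)\in E$. $\varphi_{\mathit{GadLin}}$ is the node property accepting a node of a graph $G$ of dimension $3$ iff $G$ is isomorphic to $\mathsf{gad}(G')$ for some strict linear order $G'$. **Theorem.** There are strictly more $\mathrm{FO}$ properties expressible in $\mathsf{inf}\text{-}C^2$ than properties expressible in $C^2$, both over directed and over undirected graphs. Precisely: 1. For every $d$, over directed graphs of dimension $d$, the node properties expressible in $C^2$ form a proper subset of those expressible both in $\mathrm{FO}$ and in $\mathsf{inf}\text{-}C^2$. The property $\varphi_{\mathit{Lin}}$ is a witness: it is expressible in $\mathrm{FO}$ and by a countable conjunction $\bigwedge_{n\in\mathbb N}\chi_n$ of (finitary) $C^2$ formulas, but not in $C^2$. 2. For every $d$, over undirected graphs of dimension $d$, every node property expressible in $C^2$ is expressible both in $\mathrm{FO}$ and in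 $\mathsf{inf}\text{-}C^2$; and for $d=3$ the inclusion is proper. The property $\varphi_{\mathit{GadLin}}$ is a witness: over undirected graphs of dimension $3$ it is expressible in $\mathrm{FO}$ and by a countable conjunction $\bigwedge_{n\in\mathbb N}\chi_n$ of (finitary) $C^2$ formulas, but not in $C^2$. -/

import Mathlib

namespace GraphLogic

/-! ### Graphs -/

/-- A directed, node-labelled, finite, simple graph of dimension `d`: a finite set `V` of nodes,
a set of directed edges without loops, and a labelling of the nodes by vectors in `{0,1}^d`. -/
structure LGraph (d : ℕ) where
  V : Type
  [finite_V : Finite V]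
  Adj : V → V → Prop
  loopless : ∀ v, ¬ Adj v v
  label : V → Fin d → Bool

attribute [instance] LGraph.finite_V

variable {d : ℕ}

/-- Undirected graphs are identified with directed graphs whose edge relation is symmetric. -/
def LGraph.IsUndirected (G : LGraph d) : Prop := ∀ u v, G.Adj u v → G.Adj v u

/-- The class of all directed graphs of dimension `d`. -/
def directedGraphs (d : ℕ) : Set (LGraph d) := Set.univ

/-- The class of all undirected graphs of dimension `d`. -/
def undirectedGraphs (d : ℕ) : Set (LGraph d) := {G | G.IsUndirected}

/-- Isomorphism of labelled graphs. -/
def LGraph.Isomorphic (G H : LGraph d) : Prop :=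
  ∃ e : G.V ≃ H.V, (∀ u v, G.Adj u v ↔ H.Adj (e u) (e v)) ∧ ∀ v, G.label v = H.label (e v)

/-- The edge relation is a strict linear order on the nodes. -/
def LGraph.IsStrictLinearOrder (G : LGraph d) : Prop :=
  (∀ u, ¬ G.Adj u u) ∧
  (∀ u v, u = v ∨ G.Adj u v ∨ G.Adj v u) ∧
  (∀ u v w, G.Adj u v → G.Adj v w → G.Adj u w)

/-! ### Gadgetisation -/

/-- The set of directed edges. -/
abbrev LGraph.Edge (G : LGraph d) : Type := {p : G.V × G.V // G.Adj p.1 p.2}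

/-- Nodes of the gadgetisation: `node1 u` for nodes `u`, and `node2 e`, `node3 e` for edges `e`. -/
inductive GadNode (G : LGraph d) : Type
  | node1 (u : G.V) : GadNode G
  | node2 (e : G.Edge) : GadNode G
  | node3 (e : G.Edge) : GadNode G

instance (G : LGraph d) : Finite (GadNode G) := by
  let f : GadNode G → G.V ⊕ G.Edge ⊕ G.Edge := fun
    | .node1 u => .inl u
    | .node2 e => .inr (.inl e)
    | .node3 e => .inr (.inr e)
  refine Finite.of_injective f ?_
  rintro (u | e | e) (v | e' | e') h <;> simp_all [f]

/-- The three edges of the path `node1 u, node2 (u, w), node3 (u, w), node1 w`, traversed in this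
direction. -/
inductive GadStep (G : LGraph d) : GadNode G → GadNode G → Prop
  | step12 (e : G.Edge) : GadStep G (.node1 e.1.1) (.node2 e)
  | step23 (e : G.Edge) : GadStep G (.node2 e) (.node3 e)
  | step31 (e : G.Edge) : GadStep G (.node3 e) (.node1 e.1.2)

/-- Labels of the gadgetisation: `(1,0,0)`, `(0,1,0)` and `(0,0,1)`. -/
def gadLabel (G : LGraph d) : GadNode G → Fin 3 → Bool
  | .node1 _ => ![true, false, false]
  | .node2 _ => ![false, true, false]
  | .node3 _ => ![false, false, true]

/-- The gadgetisation of a directed graph: an undirected graph of dimension 3 in which every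
directed edge `(u, w)` is replaced by an undirected path with three edges. -/
def gad (G : LGraph d) : LGraph 3 where
  V := GadNode G
  Adj a b := GadStep G a b ∨ GadStep G b a
  loopless := by
    intro v h
    have h' : GadStep G v v := h.elim id id
    cases h'
  label := gadLabel G

/-! ### Node properties and the two witnesses -/

/-- A property of nodes of graphs (a Boolean node classifier). -/
abbrev NodeProperty (d : ℕ) : Type 1 := (G : LGraph d) → G.V → Prop

/-- Accepts a node of `G` iff `G` is a strict linear order. -/
def phiLin (d : ℕ) : NodeProperty d := fun G _ => G.IsStrictLinearOrder

/-- Accepts a node of `G` iff `G` is isomorphic to the gadgetisation of a strict linear order. -/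
def phiGadLin : NodeProperty 3 := fun G _ =>
  ∃ (k : ℕ) (L : LGraph k), L.IsStrictLinearOrder ∧ G.Isomorphic (gad L)

/-! ### First-order logic (with Mathlib's syntax and semantics) -/

/-- Relation symbols: a binary `E` and unary `P_1, …, P_d`. -/
inductive GraphRel (d : ℕ) : ℕ → Type
  | edge : GraphRel d 2
  | label (i : Fin d) : GraphRel d 1

/-- The vocabulary of graphs of dimension `d`. -/
def graphLanguage (d : ℕ) : FirstOrder.Language where
  Functions := fun _ => Empty
  Relations := GraphRel d

/-- A graph as a first-order structure. -/
instance graphStructure (G : LGraph d) : (graphLanguage d).Structure G.V where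
  funMap := fun f => nomatch f
  RelMap := fun r => match r with
    | .edge => fun a => G.Adj (a 0) (a 1)
    | .label i => fun a => G.label (a 0) i = true

/-- Over the graphs in `C`, the first-order formula `φ(x)`, with exactly one free variable,
expresses the node property `Q`. -/
def FOExpresses (C : Set (LGraph d)) (φ : (graphLanguage d).Formula Unit)
    (Q : NodeProperty d) : Prop :=
  φ.freeVarFinset = {()} ∧ ∀ G ∈ C, ∀ v : G.V, φ.Realize (fun _ => v) ↔ Q G v

/-- The node properties expressible in first-order logic over the graphs in `C`. -/
def FOProperties (C : Set (LGraph d)) : Set (NodeProperty d) :=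
  {Q | ∃ φ, FOExpresses C φ Q}

/-! ### Two-variable logic with counting -/

/-- Formulas of `C²`. The two variables are the elements of `Fin 2` (`x` is `0`, `y` is `1`), and
`existsAtLeast k z φ` is the counting quantifier `∃_k z φ`. The remaining Boolean connectives and
`∀`, `∃` are definable. -/
inductive C2 (d : ℕ) : Type
  | eq (z w : Fin 2) : C2 d
  | edge (z w : Fin 2) : C2 d
  | label (i : Fin d) (z : Fin 2) : C2 d
  | neg (φ : C2 d) : C2 d
  | and (φ ψ : C2 d) : C2 d
  | or (φ ψ : C2 d) : C2 d
  | existsAtLeast (k : ℕ) (z : Fin 2) (φ : C2 d) : C2 d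

/-- Free variables of a `C²` formula. -/
def C2.freeVars : C2 d → Set (Fin 2)
  | .eq z w => {z, w}
  | .edge z w => {z, w}
  | .label _ z => {z}
  | .neg φ => φ.freeVars
  | .and φ ψ => φ.freeVars ∪ ψ.freeVars
  | .or φ ψ => φ.freeVars ∪ ψ.freeVars
  | .existsAtLeast _ z φ => φ.freeVars \ {z}

/-- Satisfaction of a `C²` formula in a graph under an assignment of the two variables. -/
def C2.Sat (G : LGraph d) : C2 d → (Fin 2 → G.V) → Prop
  | .eq z w, s => s z = s w
  | .edge z w, s => G.Adj (s z) (s w)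
  | .label i z, s => G.label (s z) i = true
  | .neg φ, s => ¬ φ.Sat G s
  | .and φ ψ, s => φ.Sat G s ∧ ψ.Sat G s
  | .or φ ψ, s => φ.Sat G s ∨ ψ.Sat G s
  | .existsAtLeast k z φ, s => k ≤ {v : G.V | φ.Sat G (Function.update s z v)}.ncard

/-- Over the graphs in `C`, the `C²` formula `φ(x)`, with exactly one free variable `x`,
expresses the node property `Q`. -/
def C2Expresses (C : Set (LGraph d)) (φ : C2 d) (Q : NodeProperty d) : Prop :=
  φ.freeVars = {0} ∧ ∀ G ∈ C, ∀ s : Fin 2 → G.V, φ.Sat G s ↔ Q G (s 0)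

/-- The node properties expressible in `C²` over the graphs in `C`. -/
def C2Properties (C : Set (LGraph d)) : Set (NodeProperty d) :=
  {Q | ∃ φ, C2Expresses C φ Q}

/-! ### Infinitary two-variable logic with counting -/

/-- Formulas of infinitary `C²`: as `C²`, and closed under conjunctions and disjunctions of
arbitrary families of formulas. -/
inductive InfC2 (d : ℕ) : Type 1
  | eq (z w : Fin 2) : InfC2 d
  | edge (z w : Fin 2) : InfC2 d
  | label (i : Fin d) (z : Fin 2) : InfC2 d
  | neg (φ : InfC2 d) : InfC2 d
  | and (φ ψ : InfC2 d) : InfC2 d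
  | or (φ ψ : InfC2 d) : InfC2 d
  | existsAtLeast (k : ℕ) (z : Fin 2) (φ : InfC2 d) : InfC2 d
  | iAnd (ι : Type) (φ : ι → InfC2 d) : InfC2 d
  | iOr (ι : Type) (φ : ι → InfC2 d) : InfC2 d

/-- Free variables of an infinitary `C²` formula. -/
def InfC2.freeVars : InfC2 d → Set (Fin 2)
  | .eq z w => {z, w}
  | .edge z w => {z, w}
  | .label _ z => {z}
  | .neg φ => φ.freeVars
  | .and φ ψ => φ.freeVars ∪ ψ.freeVars
  | .or φ ψ => φ.freeVars ∪ ψ.freeVars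
  | .existsAtLeast _ z φ => φ.freeVars \ {z}
  | .iAnd _ φ => ⋃ i, (φ i).freeVars
  | .iOr _ φ => ⋃ i, (φ i).freeVars

/-- Satisfaction of an infinitary `C²` formula. -/
def InfC2.Sat (G : LGraph d) : InfC2 d → (Fin 2 → G.V) → Prop
  | .eq z w, s => s z = s w
  | .edge z w, s => G.Adj (s z) (s w)
  | .label i z, s => G.label (s z) i = true
  | .neg φ, s => ¬ φ.Sat G s
  | .and φ ψ, s => φ.Sat G s ∧ ψ.Sat G s
  | .or φ ψ, s => φ.Sat G s ∨ ψ.Sat G s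
  | .existsAtLeast k z φ, s => k ≤ {v : G.V | φ.Sat G (Function.update s z v)}.ncard
  | .iAnd _ φ, s => ∀ i, (φ i).Sat G s
  | .iOr _ φ, s => ∃ i, (φ i).Sat G s

/-- A (finitary) `C²` formula, viewed as a formula of infinitary `C²`. -/
def C2.toInf : C2 d → InfC2 d
  | .eq z w => .eq z w
  | .edge z w => .edge z w
  | .label i z => .label i z
  | .neg φ => .neg φ.toInf
  | .and φ ψ => .and φ.toInf ψ.toInf
  | .or φ ψ => .or φ.toInf ψ.toInf
  | .existsAtLeast k z φ => .existsAtLeast k z φ.toInf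

/-- The countable conjunction `⋀ n, χ n` of a sequence of `C²` formulas. -/
def countableConj (χ : ℕ → C2 d) : InfC2 d := .iAnd ℕ fun n => (χ n).toInf

/-- Over the graphs in `C`, the infinitary `C²` formula `φ(x)`, with exactly one free variable `x`,
expresses the node property `Q`. -/
def InfC2Expresses (C : Set (LGraph d)) (φ : InfC2 d) (Q : NodeProperty d) : Prop :=
  φ.freeVars = {0} ∧ ∀ G ∈ C, ∀ s : Fin 2 → G.V, φ.Sat G s ↔ Q G (s 0)

/-- The node properties expressible in infinitary `C²` over the graphs in `C`. -/
def InfC2Properties (C : Set (LGraph d)) : Set (NodeProperty d) :=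
  {Q | ∃ φ, InfC2Expresses C φ Q}

end GraphLogic

open GraphLogic

/-! Every `C2` formula translates into `FO` (a counting quantifier becomes a block of pairwise
distinct witnesses) and embeds in infinitary `C2`, so everything rests on the two witnesses.

Lower bounds. Nodes are coloured at levels `0, …, Q` so that the colour at level `q + 1` determines,
up to a threshold `c`, how many nodes of each level-`q` colour stand in each atomic relation to the
given node. Equally coloured nodes then agree on formulas of quantifier depth at most `Q` and counts
at most `c` (`C2.sat_iff_of_countsExtend`). In a linear order, positions within `q * c` of an end
keep their own colour and the rest share one. Seen from a middle position of level `q + 1`, there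
are at least `c` middle positions of level `q` on either side, and that is all a count up to `c` can
register. Reversing an edge deep in the middle creates a directed 3-cycle without changing any of
this. For gadgetisations, the second halves of two gadget paths through a common node are exchanged
instead: local structure and colours survive, but a triangle appears, and no gadgetisation contains
one (`gad_not_triangle`).

Upper bounds. In a strict linear order on `N` nodes the out-degrees are `0, …, N - 1`, and the
successors of a node of out-degree `n` have out-degrees `0, …, n - 1`. Conversely, suppose
out-degrees are injective and every node of out-degree `n` has a successor of each out-degree `j <
n`. By pigeonhole its `n` successors realise exactly these values, so adjacency is comparison of
out-degrees and hence a linear order. Each `n` costs one `C2` sentence, whence a countable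
conjunction. On gadgetisations the same argument counts the gadget paths leaving a node, alongside a
`C2` description of the local structure. In `FO`, transitivity is stated directly, and for
gadgetisations through the relation `GadReach`. -/

namespace GraphLogic

variable {d : ℕ}

/-! ### Uniform definability in first-order logic -/

/-- `P` is defined, uniformly over all graphs, by a first-order formula with variables in `α`. -/
def FODefinable {α : Type} (P : (G : LGraph d) → (α → G.V) → Prop) : Prop :=
  ∃ φ : (graphLanguage d).Formula α, ∀ G s, φ.Realize s ↔ P G s

namespace FODefinable

open FirstOrder Language

variable {α β : Type} {P Q : (G : LGraph d) → (α → G.V) → Prop}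

theorem congr (h : FODefinable P) (hPQ : ∀ G s, P G s ↔ Q G s) : FODefinable Q := by
  obtain ⟨φ, hφ⟩ := h
  exact ⟨φ, fun G s => (hφ G s).trans (hPQ G s)⟩

theorem eq (a b : α) : FODefinable fun (G : LGraph d) (s : α → G.V) => s a = s b :=
  ⟨Term.equal (Term.var a) (Term.var b), fun G s => by simp⟩

theorem adj (a b : α) : FODefinable fun (G : LGraph d) (s : α → G.V) => G.Adj (s a) (s b) :=
  ⟨Relations.formula₂ (L := graphLanguage d) GraphRel.edge (Term.var a) (Term.var b),
    fun _ _ => Formula.realize_rel₂.trans Iff.rfl⟩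

theorem label (i : Fin d) (a : α) :
    FODefinable fun (G : LGraph d) (s : α → G.V) => G.label (s a) i = true :=
  ⟨Relations.formula₁ (L := graphLanguage d) (GraphRel.label i) (Term.var a),
    fun _ _ => Formula.realize_rel₁.trans Iff.rfl⟩

theorem not (h : FODefinable P) : FODefinable fun (G : LGraph d) s => ¬ P G s := by
  obtain ⟨φ, hφ⟩ := h
  exact ⟨φ.not, fun G s => by rw [Formula.realize_not, hφ]⟩

theorem and (h : FODefinable P) (h' : FODefinable Q) :
    FODefinable fun (G : LGraph d) s => P G s ∧ Q G s := by
  obtain ⟨φ, hφ⟩ := h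
  obtain ⟨ψ, hψ⟩ := h'
  exact ⟨φ ⊓ ψ, fun G s => by rw [Formula.realize_inf, hφ, hψ]⟩

theorem imp (h : FODefinable P) (h' : FODefinable Q) :
    FODefinable fun (G : LGraph d) s => P G s → Q G s :=
  (h.and h'.not).not.congr fun G s => by tauto

theorem or (h : FODefinable P) (h' : FODefinable Q) :
    FODefinable fun (G : LGraph d) s => P G s ∨ Q G s :=
  (h.not.imp h').congr fun G s => by tauto

theorem relabel (h : FODefinable P) (f : α → β) :
    FODefinable fun (G : LGraph d) (s : β → G.V) => P G (s ∘ f) := by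
  obtain ⟨φ, hφ⟩ := h
  exact ⟨φ.relabel f, fun G s => by rw [Formula.realize_relabel, hφ]⟩

theorem iInf [Finite β] {R : β → (G : LGraph d) → (α → G.V) → Prop}
    (h : ∀ b, FODefinable (R b)) : FODefinable fun (G : LGraph d) s => ∀ b, R b G s := by
  choose φ hφ using h
  exact ⟨Formula.iInf φ, fun G s => by simp only [Formula.realize_iInf, hφ]⟩

theorem iExs [Finite β] {R : (G : LGraph d) → (α ⊕ β → G.V) → Prop} (h : FODefinable R) :
    FODefinable fun (G : LGraph d) (s : α → G.V) => ∃ t : β → G.V, R G (Sum.elim s t) := by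
  obtain ⟨φ, hφ⟩ := h
  exact ⟨φ.iExs β, fun G s => by simp only [Formula.realize_iExs, hφ]⟩

/-- The `k` witnesses are fresh variables indexed by `Fin k`, required to be pairwise distinct;
substituting one of them for `z` is a relabelling of variables. -/
theorem existsAtLeast [DecidableEq α] (h : FODefinable P) (k : ℕ) (z : α) :
    FODefinable fun (G : LGraph d) (s : α → G.V) =>
      k ≤ {v : G.V | P G (Function.update s z v)}.ncard := by
  have hinj : FODefinable fun (G : LGraph d) (s : α ⊕ Fin k → G.V) =>
      ∀ p : Fin k × Fin k, p.1 ≠ p.2 → s (Sum.inr p.1) ≠ s (Sum.inr p.2) := by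
    refine iInf fun p => ?_
    by_cases hp : p.1 = p.2
    -- On the diagonal the condition is vacuous, so a tautology defines it.
    · obtain ⟨φ, hφ⟩ := eq (d := d) (Sum.inr p.1 : α ⊕ Fin k) (Sum.inr p.1)
      exact ⟨φ, fun G s => by simp [hφ, hp]⟩
    · exact (eq (Sum.inr p.1) (Sum.inr p.2)).not.congr fun G s => by simp [hp]
  have hP : FODefinable fun (G : LGraph d) (s : α ⊕ Fin k → G.V) =>
      ∀ i : Fin k, P G (s ∘ fun w => if w = z then Sum.inr i else Sum.inl w) :=
    iInf fun i => h.relabel _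
  refine (hinj.and hP).iExs.congr fun G s => ?_
  have key : ∀ (t : Fin k → G.V) (i : Fin k),
      (Sum.elim s t ∘ fun w => if w = z then Sum.inr i else Sum.inl w) =
        Function.update s z (t i) := by
    intro t i
    funext w
    by_cases hw : w = z <;> simp [hw]
  simp only [key, Sum.elim_inr]
  constructor
  · rintro ⟨t, ht, hPt⟩
    have hi : Function.Injective t := fun i j hij => by
      by_contra hne
      exact ht (i, j) hne hij
    have := Set.ncard_le_ncard (s := Set.range t)
      (t := {v : G.V | P G (Function.update s z v)})
      (by rintro _ ⟨i, rfl⟩; exact hPt i) (Set.toFinite _)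
    rwa [← Set.image_univ, Set.ncard_image_of_injective _ hi, Set.ncard_univ, Nat.card_eq_fintype_card,
      Fintype.card_fin] at this
  · intro hk
    obtain ⟨T, hT, hTk⟩ := Set.exists_subset_card_eq hk
    have hTf : T.Finite := Set.toFinite _
    have : Nat.card T = k := hTk
    let e := Finite.equivFinOfCardEq this
    refine ⟨fun i => (e.symm i : G.V), fun p hp heq => hp ?_, fun i => hT (e.symm i).2⟩
    exact e.symm.injective (Subtype.ext heq)

theorem exists_ [DecidableEq α] (z : α) (h : FODefinable P) :
    FODefinable fun (G : LGraph d) (s : α → G.V) => ∃ v, P G (Function.update s z v) :=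
  (h.existsAtLeast 1 z).congr fun G s => by
    rw [Nat.one_le_iff_ne_zero, ← Nat.pos_iff_ne_zero, Set.ncard_pos (Set.toFinite _)]
    rfl

theorem forall_ [DecidableEq α] (z : α) (h : FODefinable P) :
    FODefinable fun (G : LGraph d) (s : α → G.V) => ∀ v, P G (Function.update s z v) :=
  (h.not.exists_ z).not.congr fun G s => by simp

/-- First-order definable predicates are invariant under isomorphism. -/
theorem iff_of_equiv (h : FODefinable P) {G H : LGraph d} (e : G.V ≃ H.V)
    (hadj : ∀ u v, G.Adj u v ↔ H.Adj (e u) (e v)) (hlab : ∀ v, G.label v = H.label (e v))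
    (s : α → G.V) : P G s ↔ P H (e ∘ s) := by
  obtain ⟨φ, hφ⟩ := h
  let g : G.V ≃[graphLanguage d] H.V :=
    { e with
      map_fun' := fun f => nomatch f
      map_rel' := fun r x => by
        cases r with
        | edge => exact (hadj _ _).symm
        | label i =>
          change H.label (e (x 0)) i = true ↔ G.label (x 0) i = true
          rw [hlab] }
  rw [← hφ, ← hφ]
  exact (StrongHomClass.realize_formula g φ).symm

end FODefinable

/-- All variables are merged into one, and the conjunct `x = x` makes that one occur freely even
when the defining formula is a sentence. -/
theorem mem_FOProperties {α : Type} {C : Set (LGraph d)}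
    {P : (G : LGraph d) → (α → G.V) → Prop} (h : FODefinable P) {Q : NodeProperty d}
    (hPQ : ∀ G ∈ C, ∀ v, P G (fun _ => v) ↔ Q G v) : Q ∈ FOProperties C := by
  obtain ⟨φ, hφ⟩ := h.relabel (fun _ => ())
  let ψ : (graphLanguage d).Formula Unit :=
    FirstOrder.Language.Term.equal (FirstOrder.Language.Term.var ())
      (FirstOrder.Language.Term.var ())
  refine ⟨ψ ⊓ φ, ?_, fun G hG v => ?_⟩
  · refine Finset.eq_singleton_iff_unique_mem.2 ⟨?_, fun _ _ => rfl⟩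
    have h1 : () ∈ ψ.freeVarFinset := by
      simp [ψ, FirstOrder.Language.Term.equal, FirstOrder.Language.Term.bdEqual,
        FirstOrder.Language.BoundedFormula.freeVarFinset, FirstOrder.Language.Term.relabel,
        FirstOrder.Language.Term.varFinsetLeft]
    exact Finset.mem_union_left _ (Finset.mem_union_left _ h1)
  · rw [FirstOrder.Language.Formula.realize_inf, hφ, ← hPQ G hG v]
    simp [ψ, Function.comp_def]

/-! ### Uniform definability in two-variable logic with counting -/

/-- `P` is defined, uniformly over all graphs, by a formula of `C²`. -/
def C2Definable (P : (G : LGraph d) → (Fin 2 → G.V) → Prop) : Prop :=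
  ∃ φ : C2 d, ∀ G s, φ.Sat G s ↔ P G s

namespace C2Definable

variable {P Q : (G : LGraph d) → (Fin 2 → G.V) → Prop}

theorem congr (h : C2Definable P) (hPQ : ∀ G s, P G s ↔ Q G s) : C2Definable Q := by
  obtain ⟨φ, hφ⟩ := h
  exact ⟨φ, fun G s => (hφ G s).trans (hPQ G s)⟩

theorem eq (a b : Fin 2) : C2Definable fun (_ : LGraph d) s => s a = s b :=
  ⟨.eq a b, fun _ _ => Iff.rfl⟩

theorem adj (a b : Fin 2) : C2Definable fun (G : LGraph d) s => G.Adj (s a) (s b) :=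
  ⟨.edge a b, fun _ _ => Iff.rfl⟩

theorem label (i : Fin d) (a : Fin 2) :
    C2Definable fun (G : LGraph d) s => G.label (s a) i = true :=
  ⟨.label i a, fun _ _ => Iff.rfl⟩

theorem true_ : C2Definable fun (_ : LGraph d) _ => True :=
  (eq 0 0).congr fun _ _ => by simp

theorem not (h : C2Definable P) : C2Definable fun (G : LGraph d) s => ¬ P G s := by
  obtain ⟨φ, hφ⟩ := h
  exact ⟨.neg φ, fun G s => not_congr (hφ G s)⟩

theorem and (h : C2Definable P) (h' : C2Definable Q) :
    C2Definable fun (G : LGraph d) s => P G s ∧ Q G s := by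
  obtain ⟨φ, hφ⟩ := h
  obtain ⟨ψ, hψ⟩ := h'
  exact ⟨.and φ ψ, fun G s => and_congr (hφ G s) (hψ G s)⟩

theorem or (h : C2Definable P) (h' : C2Definable Q) :
    C2Definable fun (G : LGraph d) s => P G s ∨ Q G s :=
  (h.not.and h'.not).not.congr fun G s => by tauto

theorem imp (h : C2Definable P) (h' : C2Definable Q) :
    C2Definable fun (G : LGraph d) s => P G s → Q G s :=
  (h.and h'.not).not.congr fun G s => by tauto

/-- The bound `n` is a fixed number, so this is a finite conjunction and uses no variable. -/
theorem forall_lt {R : ℕ → (G : LGraph d) → (Fin 2 → G.V) → Prop} (h : ∀ j, C2Definable (R j))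
    (n : ℕ) : C2Definable fun (G : LGraph d) s => ∀ j < n, R j G s := by
  induction n with
  | zero => exact true_.congr fun _ _ => by simp
  | succ n ih => exact (ih.and (h n)).congr fun G s => by rw [Nat.forall_lt_succ_right]

theorem existsAtLeast (k : ℕ) (z : Fin 2) (h : C2Definable P) :
    C2Definable fun (G : LGraph d) s => k ≤ {v : G.V | P G (Function.update s z v)}.ncard := by
  obtain ⟨φ, hφ⟩ := h
  exact ⟨.existsAtLeast k z φ, fun G s => by simp only [C2.Sat, hφ]⟩

theorem existsExactly (k : ℕ) (z : Fin 2) (h : C2Definable P) :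
    C2Definable fun (G : LGraph d) s => {v : G.V | P G (Function.update s z v)}.ncard = k :=
  ((h.existsAtLeast k z).and (h.existsAtLeast (k + 1) z).not).congr fun G s => by omega

theorem exists_ (z : Fin 2) (h : C2Definable P) :
    C2Definable fun (G : LGraph d) s => ∃ v, P G (Function.update s z v) :=
  (h.existsAtLeast 1 z).congr fun G s => by
    rw [Nat.one_le_iff_ne_zero, ← Nat.pos_iff_ne_zero, Set.ncard_pos (Set.toFinite _)]
    rfl

theorem forall_ (z : Fin 2) (h : C2Definable P) :
    C2Definable fun (G : LGraph d) s => ∀ v, P G (Function.update s z v) :=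
  (h.not.exists_ z).not.congr fun G s => by simp

theorem existsUnique (z : Fin 2) (h : C2Definable P) :
    C2Definable fun (G : LGraph d) s => ∃! v, P G (Function.update s z v) :=
  (h.existsExactly 1 z).congr fun G s => by
    rw [Set.ncard_eq_one, ExistsUnique]
    simp only [Set.ext_iff, Set.mem_ofPred_eq, Set.mem_singleton_iff]
    exact exists_congr fun a => ⟨fun H => ⟨(H a).2 rfl, fun b => (H b).1⟩,
      fun H b => ⟨H.2 b, fun hb => hb ▸ H.1⟩⟩

/-- Besides the inclusion of logics, this gives isomorphism invariance of `C2`-definable predicates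
through `FODefinable.iff_of_equiv`. -/
theorem foDefinable (h : C2Definable P) : FODefinable P := by
  obtain ⟨φ, hφ⟩ := h
  refine FODefinable.congr (P := fun G s => φ.Sat G s) ?_ hφ
  clear hφ
  induction φ with
  | eq z w => exact .eq z w
  | edge z w => exact .adj z w
  | label i z => exact .label i z
  | neg φ ih => exact ih.not
  | and φ ψ ih ih' => exact ih.and ih'
  | or φ ψ ih ih' => exact ih.or ih'
  | existsAtLeast k z φ ih => exact ih.existsAtLeast k z

end C2Definable

theorem C2.freeVars_toInf (φ : C2 d) : φ.toInf.freeVars = φ.freeVars := by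
  induction φ <;> simp_all [C2.toInf, C2.freeVars, InfC2.freeVars]

theorem C2.sat_toInf (φ : C2 d) (G : LGraph d) (s : Fin 2 → G.V) :
    φ.toInf.Sat G s ↔ φ.Sat G s := by
  induction φ generalizing s <;> simp_all [C2.toInf, C2.Sat, InfC2.Sat]

theorem C2Properties_subset (C : Set (LGraph d)) :
    C2Properties C ⊆ FOProperties C ∩ InfC2Properties C := by
  rintro Q ⟨φ, hφ, h⟩
  refine ⟨?_, φ.toInf, by rw [C2.freeVars_toInf, hφ], fun G hG s => by
    rw [C2.sat_toInf, h G hG s]⟩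
  have : C2Definable fun (G : LGraph d) s => φ.Sat G s := ⟨φ, fun _ _ => Iff.rfl⟩
  exact mem_FOProperties this.foDefinable fun G hG v => h G hG _

/-- Binding `y` and adding `x = x` turns a formula into one with exactly one free variable. -/
theorem exists_countableConj {C : Set (LGraph d)} {Q : NodeProperty d}
    {P : ℕ → (G : LGraph d) → G.V → Prop}
    (h : ∀ n, C2Definable fun (G : LGraph d) s => P n G (s 0))
    (hPQ : ∀ G ∈ C, ∀ v, (∀ n, P n G v) ↔ Q G v) :
    ∃ χ : ℕ → C2 d, InfC2Expresses C (countableConj χ) Q := by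
  choose φ hφ using h
  refine ⟨fun n => .and (.eq 0 0) (.existsAtLeast 1 1 (φ n)), ?_, fun G hG s => ?_⟩
  · have hone : ∀ n, ({0, 0} : Set (Fin 2)) ∪ ((φ n).freeVars \ {1}) = {0} := by
      intro n
      ext w
      simp only [Set.mem_union, Set.mem_insert_iff, Set.mem_singleton_iff, Set.mem_sdiff, or_self]
      omega
    simp only [countableConj, InfC2.freeVars, C2.toInf, C2.freeVars_toInf, hone, Set.iUnion_const]
  · rw [← hPQ G hG (s 0)]
    refine forall_congr' fun n => ?_
    rw [C2.sat_toInf]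
    simp only [C2.Sat, hφ, true_and]
    rw [Nat.one_le_iff_ne_zero, ← Nat.pos_iff_ne_zero, Set.ncard_pos (Set.toFinite _)]
    simp only [ne_eq, zero_ne_one, not_false_eq_true, Function.update_of_ne]
    exact ⟨fun ⟨_, hv⟩ => hv, fun hv => ⟨s 1, hv⟩⟩

/-! ### A colouring criterion for indistinguishability by formulas of bounded rank -/

/-- The nesting depth of quantifiers. -/
def C2.depth : C2 d → ℕ
  | .eq _ _ => 0
  | .edge _ _ => 0
  | .label _ _ => 0
  | .neg φ => φ.depth
  | .and φ ψ => max φ.depth ψ.depth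
  | .or φ ψ => max φ.depth ψ.depth
  | .existsAtLeast _ _ φ => φ.depth + 1

/-- The largest count occurring in a quantifier. -/
def C2.width : C2 d → ℕ
  | .eq _ _ => 0
  | .edge _ _ => 0
  | .label _ _ => 0
  | .neg φ => φ.width
  | .and φ ψ => max φ.width ψ.width
  | .or φ ψ => max φ.width ψ.width
  | .existsAtLeast k _ φ => max k φ.width

/-- If, up to the threshold `c`, the fibres of `g` are at least as large as those of `f`, then
so are the unions of fibres. -/
theorem le_ncard_of_fibres {V W κ : Type*} [Finite V] [Finite W] {f : V → κ} {g : W → κ}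
    {c k : ℕ} {P : V → Prop} {Q : W → Prop}
    (h : ∀ z, c ≤ {y | g y = f z}.ncard ∨ {y | f y = f z}.ncard ≤ {y | g y = f z}.ncard)
    (hPQ : ∀ v w, f v = g w → P v → Q w) (hk : k ≤ c) (hP : k ≤ {v | P v}.ncard) :
    k ≤ {w | Q w}.ncard := by
  classical
  have := Fintype.ofFinite V
  have := Fintype.ofFinite W
  -- Exactly `k` solutions suffice. They are sorted by `f`-fibre, so that no fibre contributes more
  -- than `k ≤ c` of them and the threshold is harmless.
  obtain ⟨T, hT, hTk⟩ := Set.exists_subset_card_eq hP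
  have hTf : T.Finite := Set.toFinite _
  lift T to Finset V using hTf
  rw [Set.ncard_coe_finset] at hTk
  have h1 : T.card = ∑ b ∈ T.image f, (T.filter fun v => f v = b).card :=
    Finset.card_eq_sum_card_fiberwise fun v hv => Finset.mem_coe.2 (Finset.mem_image_of_mem f hv)
  have h2 : (Finset.univ.filter fun w => g w ∈ T.image f).card =
      ∑ b ∈ T.image f, ((Finset.univ.filter fun w => g w ∈ T.image f).filter
        fun w => g w = b).card :=
    Finset.card_eq_sum_card_fiberwise fun w hw => by simpa using hw
  have h3 : T.card ≤ (Finset.univ.filter fun w => g w ∈ T.image f).card := by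
    rw [h1, h2]
    refine Finset.sum_le_sum fun b hb => ?_
    obtain ⟨z, hz, rfl⟩ := Finset.mem_image.1 hb
    have e1 : ((Finset.univ.filter fun w => g w ∈ T.image f).filter fun w => g w = f z).card =
        {y | g y = f z}.ncard := by
      rw [← Set.ncard_coe_finset]
      congr 1
      ext w
      simp only [Finset.coe_filter, Finset.mem_filter, Finset.mem_univ, true_and,
        Set.mem_ofPred_eq, and_iff_right_iff_imp]
      exact fun hw => hw ▸ hb
    rw [e1]
    rcases h z with h | h
    · exact ((Finset.card_filter_le _ _).trans (hTk.le.trans hk)).trans h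
    · refine le_trans ?_ h
      rw [← Set.ncard_coe_finset]
      exact Set.ncard_le_ncard (fun v hv => by simpa using (Finset.mem_filter.1 hv).2)
        (Set.toFinite _)
  rw [← hTk]
  refine h3.trans ?_
  rw [← Set.ncard_coe_finset]
  refine Set.ncard_le_ncard (fun w hw => ?_) (Set.toFinite _)
  obtain ⟨v, hv, hvw⟩ := Finset.mem_image.1 (Finset.mem_filter.1 hw).2
  exact hPQ v w hvw (hT hv)

/-- All later lower bounds by `c` or `c + 3` come from an interval of positions whose members occur
as keys. -/
theorem card_le_ncard_of_keys {V : Type*} [Finite V] {B : Set V} (S : Finset ℕ) (key : V → ℕ)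
    (h : ∀ n ∈ S, ∃ v ∈ B, key v = n) : S.card ≤ B.ncard := by
  rw [← Set.ncard_coe_finset]
  refine (Set.ncard_le_ncard (t := key '' B) ?_ (Set.toFinite _)).trans
    (Set.ncard_image_le (Set.toFinite _))
  intro n hn
  exact h n hn

/-- The atomic type of the pair `(x, y)`, up to labels. -/
def atomType (G : LGraph d) (x y : G.V) : Prop × Prop × Prop := (x = y, G.Adj x y, G.Adj y x)

/-- The colour of `y` together with its atomic type over `x`. -/
def pairType {K : Type} (G : LGraph d) (col : G.V → K) (x y : G.V) : K × Prop × Prop × Prop :=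
  (col y, atomType G x y)

/-- Every type over `x` is realised over `x'` as often as over `x`, or at least `c` times, whenever
`x` and `x'` have the same colour of the next level. -/
def CountsExtend {K : Type} (G H : LGraph d) (col : ℕ → G.V → K) (col' : ℕ → H.V → K)
    (c Q : ℕ) : Prop :=
  ∀ q < Q, ∀ x x', col (q + 1) x = col' (q + 1) x' → ∀ z,
    c ≤ {y | pairType H (col' q) x' y = pairType G (col q) x z}.ncard ∨
    {y | pairType G (col q) x y = pairType G (col q) x z}.ncard ≤
      {y | pairType H (col' q) x' y = pairType G (col q) x z}.ncard

/-- Induction on the formula. A quantifier over one variable keeps the other, whose colour of level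
`q + 1` controls the numbers of pair types of level `q` up to `c`. By induction the truth of the
body depends only on this pair type, so `le_ncard_of_fibres` transfers the count, once in each
direction. -/
theorem C2.sat_iff_of_countsExtend {K : Type} {G H : LGraph d} {col : ℕ → G.V → K}
    {col' : ℕ → H.V → K} {c Q : ℕ}
    (hlab : ∀ q x x', col q x = col' q x' → G.label x = H.label x')
    (hmono : ∀ q < Q, ∀ x x', col (q + 1) x = col' (q + 1) x' → col q x = col' q x')
    (hGH : CountsExtend G H col col' c Q) (hHG : CountsExtend H G col' col c Q)
    (φ : C2 d) {q : ℕ} (hq : q ≤ Q) (hdepth : φ.depth ≤ q) (hwidth : φ.width ≤ c)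
    {s : Fin 2 → G.V} {s' : Fin 2 → H.V} (hcol : ∀ i, col q (s i) = col' q (s' i))
    (hs : atomType G (s 0) (s 1) = atomType H (s' 0) (s' 1)) : φ.Sat G s ↔ φ.Sat H s' := by
  have hall : ∀ {s : Fin 2 → G.V} {s' : Fin 2 → H.V},
      atomType G (s 0) (s 1) = atomType H (s' 0) (s' 1) → ∀ i j,
      (s i = s j ↔ s' i = s' j) ∧ (G.Adj (s i) (s j) ↔ H.Adj (s' i) (s' j)) := by
    intro s s' hs
    simp only [atomType, Prod.mk.injEq, eq_iff_iff] at hs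
    obtain ⟨h1, h2, h3⟩ := hs
    simp only [Fin.forall_fin_two, true_and, h1, h2, h3, G.loopless, H.loopless,
      iff_self, and_true]
    rw [eq_comm, h1, eq_comm]
  induction φ generalizing q s s' with
  | eq z w => exact (hall hs z w).1
  | edge z w => exact (hall hs z w).2
  | label i z =>
    change G.label (s z) i = true ↔ H.label (s' z) i = true
    rw [hlab q _ _ (hcol z)]
  | neg φ ih => exact not_congr (ih hq hdepth hwidth hcol hs)
  | and φ ψ ih ih' =>
    simp only [C2.depth, C2.width, max_le_iff] at hdepth hwidth
    exact and_congr (ih hq hdepth.1 hwidth.1 hcol hs) (ih' hq hdepth.2 hwidth.2 hcol hs)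
  | or φ ψ ih ih' =>
    simp only [C2.depth, C2.width, max_le_iff] at hdepth hwidth
    exact or_congr (ih hq hdepth.1 hwidth.1 hcol hs) (ih' hq hdepth.2 hwidth.2 hcol hs)
  | existsAtLeast k z φ ih =>
    simp only [C2.depth, C2.width, max_le_iff] at hdepth hwidth
    obtain ⟨q, rfl⟩ : ∃ p, q = p + 1 := ⟨q - 1, by omega⟩
    obtain ⟨w, hw⟩ : ∃ w : Fin 2, w ≠ z := exists_ne z
    have step : ∀ v v', pairType G (col q) (s w) v = pairType H (col' q) (s' w) v' →
        (φ.Sat G (Function.update s z v) ↔ φ.Sat H (Function.update s' z v')) := by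
      intro v v' hv
      simp only [pairType, Prod.mk.injEq] at hv
      obtain ⟨hv, hat⟩ := hv
      refine ih (q := q) (by omega) (by omega) hwidth.2 (fun i => ?_) ?_
      · by_cases hi : i = z
        · subst hi
          simpa using hv
        · have : i = w := by omega
          subst this
          simpa [hw] using hmono q (by omega) _ _ (hcol i)
      · simp only [atomType, Prod.mk.injEq, eq_iff_iff] at hat ⊢
        -- The pair type is seen from the kept variable `w`; if `w` is `y`, the atomic type must be
        -- read in the opposite order.
        have hz : z = 0 ∧ w = 1 ∨ z = 1 ∧ w = 0 := by omega
        rcases hz with ⟨rfl, rfl⟩ | ⟨rfl, rfl⟩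
        · simp only [Function.update_self, ne_eq, one_ne_zero, not_false_eq_true,
            Function.update_of_ne]
          exact ⟨by rw [eq_comm, hat.1, eq_comm], hat.2.2, hat.2.1⟩
        · simp only [Function.update_self, ne_eq, zero_ne_one, not_false_eq_true,
            Function.update_of_ne]
          exact hat
    simp only [C2.Sat]
    exact ⟨le_ncard_of_fibres (hGH q (by omega) _ _ (hcol w))
        (fun v v' hv => (step v v' hv).1) hwidth.1,
      le_ncard_of_fibres (hHG q (by omega) _ _ (hcol w).symm)
        (fun v v' hv => (step v' v hv.symm).2) hwidth.1⟩

/-- A node property is not expressible in `C²` if for all `c` and `Q` it separates two nodes of the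
same colour, for suitable colourings. -/
theorem notMem_C2Properties {C : Set (LGraph d)} {P : NodeProperty d}
    (h : ∀ c Q : ℕ, ∃ (K : Type) (G H : LGraph d) (col : ℕ → G.V → K) (col' : ℕ → H.V → K)
      (x : G.V) (x' : H.V), G ∈ C ∧ H ∈ C ∧
      (∀ q x x', col q x = col' q x' → G.label x = H.label x') ∧
      (∀ q < Q, ∀ x x', col (q + 1) x = col' (q + 1) x' → col q x = col' q x') ∧
      CountsExtend G H col col' c Q ∧ CountsExtend H G col' col c Q ∧
      col Q x = col' Q x' ∧ P G x ∧ ¬ P H x') : P ∉ C2Properties C := by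
  rintro ⟨φ, -, hφ⟩
  obtain ⟨K, G, H, col, col', x, x', hG, hH, hlab, hmono, hGH, hHG, hx, hP, hnP⟩ :=
    h φ.width φ.depth
  refine hnP ((hφ H hH fun _ => x').1 ?_)
  refine (C2.sat_iff_of_countsExtend hlab hmono hGH hHG φ le_rfl le_rfl le_rfl
    (s := fun _ => x) (fun _ => hx) ?_).1 ((hφ G hG fun _ => x).2 hP)
  simp [atomType, G.loopless, H.loopless]

/-! ### Positions in a linear order -/

/-- A position at distance at least `q * c` from both ends of `{0, …, N - 1}`. -/
def IsMiddle (N c q i : ℕ) : Prop := q * c ≤ i ∧ i + q * c < N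

open Classical in
/-- Middle positions are identified, and the others are distinguished. -/
noncomputable def posColour (N c q i : ℕ) : ℕ := if IsMiddle N c q i then N else i

theorem IsMiddle.of_succ {N c q i : ℕ} (h : IsMiddle N c (q + 1) i) : IsMiddle N c q i := by
  obtain ⟨h1, h2⟩ := h
  rw [add_mul, one_mul] at h1 h2
  exact ⟨by omega, by omega⟩

theorem IsMiddle.mono {N c q Q i : ℕ} (hq : q ≤ Q) (h : IsMiddle N c Q i) : IsMiddle N c q i := by
  have := Nat.mul_le_mul_right c hq
  exact ⟨this.trans h.1, by have := h.2; omega⟩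

/-- The common colour `N` of the middle is not a position below `N`, so it never clashes with the
colour of an outer position. -/
theorem posColour_eq_iff {N c q i j : ℕ} (hi : i < N) (hj : j < N) :
    posColour N c q i = posColour N c q j ↔ (IsMiddle N c q i ∧ IsMiddle N c q j) ∨ i = j := by
  unfold posColour
  split_ifs with h1 h2 h2
  · simp [h1, h2]
  · simp only [h2, and_false, false_or]
    exact ⟨fun h => by omega, fun h => absurd (h ▸ h1) h2⟩
  · simp only [h1, false_and, false_or]
    exact ⟨fun h => by omega, fun h => absurd (h ▸ h2) h1⟩
  · simp [h1]

theorem posColour_of_succ {N c q i j : ℕ} (hi : i < N) (hj : j < N)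
    (h : posColour N c (q + 1) i = posColour N c (q + 1) j) :
    posColour N c q i = posColour N c q j := by
  rw [posColour_eq_iff hi hj] at h ⊢
  exact h.imp (fun h => ⟨h.1.of_succ, h.2.of_succ⟩) id

/-! ### Linear orders are not recognised by `C²` -/

/-- The unlabelled graph with the given edges. -/
def graphOn (d N : ℕ) (R : Fin N → Fin N → Prop) (hR : ∀ i, ¬ R i i) : LGraph d where
  V := Fin N
  Adj := R
  loopless := hR
  label _ _ := false

/-- A tournament that agrees with the linear order except on pairs of middle positions. -/
structure NearlyLinear (N c Q : ℕ) (R : Fin N → Fin N → Prop) : Prop where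
  asymm : ∀ i j, R i j → ¬ R j i
  total : ∀ i j, i ≠ j → R i j ∨ R j i
  of_lt : ∀ i j : Fin N, i < j → ¬ (IsMiddle N c Q i ∧ IsMiddle N c Q j) → R i j

theorem NearlyLinear.iff_lt {N c Q : ℕ} {R : Fin N → Fin N → Prop} (hR : NearlyLinear N c Q R)
    {i j : Fin N} (h : ¬ (IsMiddle N c Q i ∧ IsMiddle N c Q j)) : R i j ↔ i < j := by
  refine ⟨fun hij => ?_, fun hij => hR.of_lt i j hij h⟩
  rcases lt_trichotomy i j with hlt | rfl | hgt
  · exact hlt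
  · exact absurd hij (hR.asymm _ _ hij)
  · exact absurd (hR.of_lt j i hgt (fun h' => h h'.symm)) (hR.asymm _ _ hij)

/-- The two tournaments can differ only inside the level-`Q` middle. Every comparison with a
position outside it is therefore the usual one, and such positions suffice to match each type or to
reach the threshold. -/
theorem NearlyLinear.countsExtend {N c Q : ℕ} {R R' : Fin N → Fin N → Prop}
    (hR : NearlyLinear N c Q R) (hR' : NearlyLinear N c Q R') (h0 : ∀ i, ¬ R i i)
    (h0' : ∀ i, ¬ R' i i) :
    CountsExtend (graphOn d N R h0) (graphOn d N R' h0') (fun q i => posColour N c q i.val)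
      (fun q i => posColour N c q i.val) c Q := by
  intro q hq (x : Fin N) (x' : Fin N) hx (z : Fin N)
  simp only [pairType, atomType, Prod.mk.injEq, eq_iff_iff, graphOn]
  change posColour N c (q + 1) x.1 = posColour N c (q + 1) x'.1 at hx
  have hcol := posColour_of_succ x.2 x'.2 hx
  have hQc : q * c + c ≤ Q * c := by
    have := Nat.mul_le_mul_right c (Nat.succ_le_of_lt hq)
    rwa [Nat.succ_mul] at this
  rw [posColour_eq_iff x.2 x'.2] at hx
  have hpos : ∀ {y : Fin N} {B : Set (Fin N)}, y ∈ B → 1 ≤ B.ncard := fun hy =>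
    Nat.one_le_iff_ne_zero.2 (Set.ncard_ne_zero_of_mem hy (Set.toFinite _))
  by_cases hzx : z = x
  · subst hzx
    right
    refine le_trans ?_ (hpos (y := x') ?_)
    · refine (Set.ncard_le_ncard (t := {z}) (fun y hy => ?_) (Set.toFinite _)).trans
        (Set.ncard_singleton z).le
      exact (hy.2.1.2 rfl).symm
    · exact ⟨hcol.symm, by simp, by simp [h0, h0'], by simp [h0, h0']⟩
  -- If `x` is not in the middle at level `q + 1`, its colour determines it, and both tournaments
  -- compare it with every position in the usual way.
  by_cases hmid : IsMiddle N c (q + 1) x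
  swap
  · have hxx : x = x' := by
      rcases hx with h | h
      · exact absurd h.1 hmid
      · exact Fin.ext h
    subst hxx
    have hmQ : ¬ IsMiddle N c Q x := fun h => hmid (h.mono hq)
    right
    refine Set.ncard_le_ncard (fun y hy => ?_) (Set.toFinite _)
    simp only [hR.iff_lt (i := x) (fun h => hmQ h.1), hR.iff_lt (j := x) (fun h => hmQ h.2),
      hR'.iff_lt (i := x) (fun h => hmQ h.1), hR'.iff_lt (j := x) (fun h => hmQ h.2)] at hy ⊢
    exact hy
  have hmid' : IsMiddle N c (q + 1) x' := by
    rcases hx with h | h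
    · exact h.2
    · exact h ▸ hmid
  obtain ⟨hm1, hm2⟩ := hmid
  obtain ⟨hm1', hm2'⟩ := hmid'
  rw [add_mul, one_mul] at hm1 hm2 hm1' hm2'
  -- If `z` is outside the level-`q` middle, it is alone in its colour and on the same side of `x`
  -- and `x'`, both of which lie in that middle.
  by_cases hz : IsMiddle N c q z
  swap
  · right
    refine le_trans ?_ (hpos (y := z) ?_)
    · refine (Set.ncard_le_ncard (t := {z}) (fun y hy => ?_) (Set.toFinite _)).trans
        (Set.ncard_singleton z).le
      rcases (posColour_eq_iff y.2 z.2).1 hy.1 with h | h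
      · exact absurd h.2 hz
      · exact Fin.ext h
    · have hzQ : ¬ IsMiddle N c Q z := fun h => hz (h.mono hq.le)
      simp only [Set.mem_ofPred_eq, hR.iff_lt (i := z) (fun h => hzQ h.1),
        hR.iff_lt (j := z) (fun h => hzQ h.2), hR'.iff_lt (i := z) (fun h => hzQ h.1),
        hR'.iff_lt (j := z) (fun h => hzQ h.2), Fin.lt_def, Fin.ext_iff, true_and]
      unfold IsMiddle at hz
      omega
  left
  have hz' := hz
  obtain ⟨hz1, hz2⟩ := hz'
  -- The outermost `c` middle positions of level `q` on the relevant side lie beyond `x'`, which is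
  -- in the middle at level `q + 1`. They are outside the level-`Q` middle because `q < Q`, so their
  -- edges to `x'` are not reversed.
  rcases hR.total x z (Ne.symm hzx) with hxz | hxz
  · have := card_le_ncard_of_keys
      (B := {y : Fin N | posColour N c q y.1 = posColour N c q z.1 ∧ (x' = y ↔ x = z) ∧
        (R' x' y ↔ R x z) ∧ (R' y x' ↔ R z x)})
      (Finset.Ico (N - (q * c + c)) (N - q * c)) (fun y : Fin N => y.1) (fun n hn => by
        rw [Finset.mem_Ico] at hn
        refine ⟨⟨n, by omega⟩, ?_, rfl⟩
        have hnQ : ¬ IsMiddle N c Q n := by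
          unfold IsMiddle
          omega
        have hlt : x' < (⟨n, by omega⟩ : Fin N) := by
          rw [Fin.lt_def]
          change x'.1 < n
          omega
        have h1 := hR'.of_lt _ _ hlt fun h => hnQ h.2
        refine ⟨(posColour_eq_iff (by change n < N; omega) z.2).2
          (Or.inl ⟨⟨by change _ ≤ n; omega, by change n + _ < N; omega⟩, hz⟩), ?_, ?_, ?_⟩
        · exact iff_of_false hlt.ne (Ne.symm hzx)
        · exact iff_of_true h1 hxz
        · exact iff_of_false (hR'.asymm _ _ h1) (hR.asymm _ _ hxz))
    rw [Nat.card_Ico] at this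
    exact le_trans (by omega) this
  · have := card_le_ncard_of_keys
      (B := {y : Fin N | posColour N c q y.1 = posColour N c q z.1 ∧ (x' = y ↔ x = z) ∧
        (R' x' y ↔ R x z) ∧ (R' y x' ↔ R z x)})
      (Finset.Ico (q * c) (q * c + c)) (fun y : Fin N => y.1) (fun n hn => by
        rw [Finset.mem_Ico] at hn
        refine ⟨⟨n, by omega⟩, ?_, rfl⟩
        have hnQ : ¬ IsMiddle N c Q n := by
          unfold IsMiddle
          omega
        have hlt : (⟨n, by omega⟩ : Fin N) < x' := by
          rw [Fin.lt_def]
          change n < x'.1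
          omega
        have h1 := hR'.of_lt _ _ hlt fun h => hnQ h.1
        refine ⟨(posColour_eq_iff (by change n < N; omega) z.2).2
          (Or.inl ⟨⟨by change _ ≤ n; omega, by change n + _ < N; omega⟩, hz⟩), ?_, ?_, ?_⟩
        · exact iff_of_false hlt.ne' (Ne.symm hzx)
        · exact iff_of_false (hR'.asymm _ _ h1) (hR.asymm _ _ hxz)
        · exact iff_of_true h1 hxz)
    rw [Nat.card_Ico] at this
    exact le_trans (by omega) this

/-- The linear order on `Fin N`, with the edge between `m` and `m + 2` reversed. -/
def reversedAt (N m : ℕ) (i j : Fin N) : Prop :=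
  if (i.1 = m ∧ j.1 = m + 2) ∨ (i.1 = m + 2 ∧ j.1 = m) then j < i else i < j

theorem phiLin_notMem_C2Properties (d : ℕ) : phiLin d ∉ C2Properties (directedGraphs d) := by
  refine notMem_C2Properties fun c Q => ?_
  -- This length leaves exactly the three middle positions `Q * c`, `Q * c + 1`, `Q * c + 2` at
  -- level `Q`, which form the directed cycle.
  obtain ⟨N, hN⟩ : ∃ N, N = 2 * (Q * c) + 3 := ⟨_, rfl⟩
  have h0 : ∀ i : Fin N, ¬ i < i := fun i => lt_irrefl i
  have h0' : ∀ i : Fin N, ¬ reversedAt N (Q * c) i i := by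
    intro i
    unfold reversedAt
    split_ifs <;> exact lt_irrefl i
  have h1 : NearlyLinear N c Q (fun i j => i < j) :=
    ⟨fun i j => lt_asymm, fun i j => lt_or_gt_of_ne, fun i j h _ => h⟩
  have h2 : NearlyLinear N c Q (reversedAt N (Q * c)) := by
    refine ⟨fun i j => ?_, fun i j => ?_, fun i j => ?_⟩
    · unfold reversedAt
      simp only [Fin.lt_def]
      split_ifs <;> omega
    · unfold reversedAt
      simp only [Fin.lt_def, ne_eq, Fin.ext_iff]
      split_ifs <;> omega
    · unfold reversedAt IsMiddle
      simp only [Fin.lt_def]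
      split_ifs <;> omega
  refine ⟨ℕ, graphOn d N _ h0, graphOn d N _ h0', fun q i => posColour N c q i.val,
    fun q i => posColour N c q i.val, (⟨0, by omega⟩ : Fin N), (⟨0, by omega⟩ : Fin N),
    Set.mem_univ _, Set.mem_univ _, fun _ _ _ _ => rfl,
    fun q _ (x : Fin N) (x' : Fin N) => posColour_of_succ x.2 x'.2,
    h1.countsExtend h2 h0 h0', h2.countsExtend h1 h0' h0, rfl, ?_, ?_⟩
  · exact ⟨h0, fun i j => by
      rcases lt_trichotomy (α := Fin N) i j with h | h | h
      exacts [Or.inr (Or.inl h), Or.inl h, Or.inr (Or.inr h)], fun _ _ _ => lt_trans (α := Fin N)⟩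
  · rintro ⟨-, -, htrans⟩
    have := htrans (⟨Q * c, by omega⟩ : Fin N) (⟨Q * c + 1, by omega⟩ : Fin N)
      (⟨Q * c + 2, by omega⟩ : Fin N) (by simp [graphOn, reversedAt]) (by simp [graphOn, reversedAt])
    simp [graphOn, reversedAt] at this

/-! ### Linear orders are recognised by out-degrees -/

/-- If `g` attains on `S` every value below the cardinality of `S`, then it is a bijection from `S`
to these values. -/
theorem lt_ncard_and_injOn_of_surjOn {E : Type*} [Finite E] {S : Set E} {g : E → ℕ}
    (h : ∀ j < S.ncard, ∃ e ∈ S, g e = j) : (∀ e ∈ S, g e < S.ncard) ∧ Set.InjOn g S := by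
  have hsub : ((Finset.range S.ncard : Finset ℕ) : Set ℕ) ⊆ g '' S := fun j hj =>
    h j (Finset.mem_range.1 hj)
  have hle : (g '' S).ncard ≤ ((Finset.range S.ncard : Finset ℕ) : Set ℕ).ncard := by
    rw [Set.ncard_coe_finset, Finset.card_range]
    exact Set.ncard_image_le (Set.toFinite _)
  have heq := Set.eq_of_subset_of_ncard_le hsub hle (Set.toFinite _)
  refine ⟨fun e he => ?_, ?_⟩
  · have : g e ∈ ((Finset.range S.ncard : Finset ℕ) : Set ℕ) := heq ▸ Set.mem_image_of_mem g he
    exact Finset.mem_range.1 this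
  · refine (Set.ncard_image_iff (Set.toFinite _)).1 ?_
    rw [← heq, Set.ncard_coe_finset, Finset.card_range]

/-- The number of successors. -/
noncomputable def LGraph.outDegree (G : LGraph d) (v : G.V) : ℕ := {w | G.Adj v w}.ncard

namespace LGraph.IsStrictLinearOrder

variable {G : LGraph d}

theorem outDegree_lt (h : G.IsStrictLinearOrder) {u v : G.V} (huv : G.Adj u v) :
    G.outDegree v < G.outDegree u := by
  refine Set.ncard_lt_ncard ⟨fun w hw => h.2.2 _ _ _ huv hw, fun hsub => ?_⟩ (Set.toFinite _)
  exact G.loopless v (hsub huv)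

theorem outDegree_injective (h : G.IsStrictLinearOrder) : Function.Injective G.outDegree := by
  intro u v huv
  rcases h.2.1 u v with h' | h' | h'
  · exact h'
  · exact absurd huv (h.outDegree_lt h').ne'
  · exact absurd huv (h.outDegree_lt h').ne

/-- Pigeonhole: the successors of `u` have distinct out-degrees below `outDegree u`, and there are
`outDegree u` of them. -/
theorem exists_adj_outDegree_eq (h : G.IsStrictLinearOrder) {u : G.V} {j : ℕ}
    (hj : j < G.outDegree u) : ∃ w, G.Adj u w ∧ G.outDegree w = j := by
  have hsub : G.outDegree '' {w | G.Adj u w} ⊆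
      ((Finset.range (G.outDegree u) : Finset ℕ) : Set ℕ) := by
    rintro _ ⟨w, hw, rfl⟩
    exact Finset.mem_coe.2 (Finset.mem_range.2 (h.outDegree_lt hw))
  have heq := Set.eq_of_subset_of_ncard_le hsub (by
    rw [Set.ncard_coe_finset, Finset.card_range,
      Set.ncard_image_of_injective _ h.outDegree_injective]
    exact le_rfl) (Set.toFinite _)
  have hmem : j ∈ G.outDegree '' {w | G.Adj u w} := by
    rw [heq]
    exact Finset.mem_coe.2 (Finset.mem_range.2 hj)
  exact hmem

end LGraph.IsStrictLinearOrder

/-- By `lt_ncard_and_injOn_of_surjOn` every successor has smaller out-degree. Conversely, a node of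
smaller out-degree is, by injectivity, the successor provided by `hex`. Thus the edge relation is
comparison of out-degrees. -/
theorem LGraph.isStrictLinearOrder_of_outDegree {G : LGraph d}
    (hinj : Function.Injective G.outDegree)
    (hex : ∀ u, ∀ j < G.outDegree u, ∃ w, G.Adj u w ∧ G.outDegree w = j) :
    G.IsStrictLinearOrder := by
  have hiff : ∀ u w, G.Adj u w ↔ G.outDegree w < G.outDegree u := by
    refine fun u w => ⟨fun h => (lt_ncard_and_injOn_of_surjOn (hex u)).1 w h, fun h => ?_⟩
    obtain ⟨w', hw', hdeg⟩ := hex u _ h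
    exact hinj hdeg ▸ hw'
  simp only [LGraph.IsStrictLinearOrder, hiff]
  refine ⟨fun u => lt_irrefl _, fun u v => ?_, fun u v w h h' => h'.trans h⟩
  rcases lt_trichotomy (G.outDegree u) (G.outDegree v) with h | h | h
  exacts [Or.inr (Or.inr h), Or.inl (hinj h), Or.inr (Or.inl h)]

/-- In `Fin 2` the term `1 - z` is the other variable, which is free to be bound. -/
theorem C2Definable.outDegree_eq (n : ℕ) (z : Fin 2) :
    C2Definable fun (G : LGraph d) s => G.outDegree (s z) = n :=
  ((adj z (1 - z)).existsExactly n (1 - z)).congr fun G s => by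
    have : z ≠ 1 - z := by omega
    simp [LGraph.outDegree, this]

theorem phiLin_mem_FOProperties (d : ℕ) : phiLin d ∈ FOProperties (directedGraphs d) := by
  have h1 : FODefinable fun (G : LGraph d) (_ : Fin 3 → G.V) =>
      ∀ u v, u = v ∨ G.Adj u v ∨ G.Adj v u :=
    ((((FODefinable.eq 0 1).or ((FODefinable.adj 0 1).or (.adj 1 0))).forall_ 1).forall_ 0).congr
      fun G s => by simp [Function.update]
  have h2 : FODefinable fun (G : LGraph d) (_ : Fin 3 → G.V) =>
      ∀ u v w, G.Adj u v → G.Adj v w → G.Adj u w :=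
    (((((FODefinable.adj 0 1).imp ((FODefinable.adj 1 2).imp (.adj 0 2))).forall_ 2).forall_
      1).forall_ 0).congr fun G s => by simp [Function.update]
  exact mem_FOProperties (h1.and h2) fun G _ v => ⟨fun h => ⟨G.loopless, h⟩, fun h => h.2⟩

theorem exists_countableConj_phiLin (d : ℕ) :
    ∃ χ : ℕ → C2 d, InfC2Expresses (directedGraphs d) (countableConj χ) (phiLin d) := by
  refine exists_countableConj (P := fun n G _ =>
    (∀ u v, G.outDegree u = n → G.outDegree v = n → u = v) ∧
    ∀ u, G.outDegree u = n → ∀ j < n, ∃ w, G.Adj u w ∧ G.outDegree w = j) (fun n => ?_) ?_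
  · have h1 : C2Definable fun (G : LGraph d) _ =>
        ∀ u v, G.outDegree u = n → G.outDegree v = n → u = v :=
      ((((C2Definable.outDegree_eq n 0).imp ((C2Definable.outDegree_eq n 1).imp
        (.eq 0 1))).forall_ 1).forall_ 0).congr fun G s => by simp
    have h2 : C2Definable fun (G : LGraph d) _ =>
        ∀ u, G.outDegree u = n → ∀ j < n, ∃ w, G.Adj u w ∧ G.outDegree w = j :=
      (((C2Definable.outDegree_eq n 0).imp (.forall_lt (fun j => .exists_ 1
        ((C2Definable.adj 0 1).and (.outDegree_eq j 1))) n)).forall_ 0).congr fun G s => by simp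
    exact h1.and h2
  · refine fun G _ v => ⟨fun h => ?_, fun h n => ⟨fun u v hu hv => ?_, ?_⟩⟩
    · exact LGraph.isStrictLinearOrder_of_outDegree (fun u v huv => (h _).1 u v huv rfl)
        fun u j hj => (h _).2 u rfl j hj
    · exact h.outDegree_injective (hu.trans hv.symm)
    · rintro u rfl j hj
      exact LGraph.IsStrictLinearOrder.exists_adj_outDegree_eq h hj

/-! ### Counting types in undirected graphs -/

theorem pairType_eq_iff {K : Type} {G H : LGraph d} (hG : G.IsUndirected) (hH : H.IsUndirected)
    {col : G.V → K} {col' : H.V → K} {x z : G.V} {x' y : H.V} :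
    pairType H col' x' y = pairType G col x z ↔
      col' y = col z ∧ (x' = y ↔ x = z) ∧ (H.Adj x' y ↔ G.Adj x z) := by
  simp only [pairType, atomType, Prod.mk.injEq, eq_iff_iff]
  have h1 : H.Adj y x' ↔ H.Adj x' y := ⟨hH _ _, hH _ _⟩
  have h2 : G.Adj z x ↔ G.Adj x z := ⟨hG _ _, hG _ _⟩
  rw [h1, h2]
  tauto

theorem ncard_le_ncard_of_subsingleton {V W : Type*} [Finite V] [Finite W] {A : Set V} {B : Set W}
    (hA : ∀ y ∈ A, ∀ y' ∈ A, y = y') (hB : B.Nonempty) : A.ncard ≤ B.ncard :=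
  ((Set.ncard_le_one (Set.toFinite _)).2 hA).trans ((Set.ncard_pos (Set.toFinite _)).2 hB)

/-- The counting condition at vertices with at most two neighbours, of different colours, when all
colour classes are singletons or large. -/
theorem count_of_few_neighbours {K : Type} {G H : LGraph d} (hG : G.IsUndirected)
    (hH : H.IsUndirected) {col : G.V → K} {col' : H.V → K} {c : ℕ} {x : G.V} {x' : H.V}
    (hx : col x = col' x')
    (hinj : ∀ y z, G.Adj x y → G.Adj x z → col y = col z → y = z)
    (hforth : ∀ z, G.Adj x z → ∃ z', H.Adj x' z' ∧ col' z' = col z)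
    (hback : ∀ z', H.Adj x' z' → ∃ z, G.Adj x z ∧ col z = col' z')
    (hdeg : {y | H.Adj x' y}.ncard ≤ 2) (z : G.V)
    (hz : ((∀ y, col y = col z → y = z) ∧ ∃ z', col' z' = col z) ∨
      c + 3 ≤ {y | col' y = col z}.ncard) :
    c ≤ {y | pairType H col' x' y = pairType G col x z}.ncard ∨
    {y | pairType G col x y = pairType G col x z}.ncard ≤
      {y | pairType H col' x' y = pairType G col x z}.ncard := by
  simp only [pairType_eq_iff hG hH, pairType_eq_iff hG hG]
  by_cases hxz : x = z
  · subst hxz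
    right
    refine ncard_le_ncard_of_subsingleton (fun y hy y' hy' => ?_) ⟨x', hx.symm, by simp,
      by simp [G.loopless, H.loopless]⟩
    exact (hy.2.1.2 rfl).symm.trans (hy'.2.1.2 rfl)
  by_cases hadj : G.Adj x z
  · right
    obtain ⟨z', hz', hcol⟩ := hforth z hadj
    refine ncard_le_ncard_of_subsingleton (fun y hy y' hy' => ?_) ⟨z', hcol,
      iff_of_false (fun h => ?_) hxz, iff_of_true hz' hadj⟩
    · exact hinj _ _ (hy.2.2.2 hadj) (hy'.2.2.2 hadj) (hy.1.trans hy'.1.symm)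
    · exact H.loopless _ (h ▸ hz')
  -- If `z` is alone in its colour, then `z'` cannot be `x'` or a neighbour of it: equality of
  -- colours and `hback` would make `z` equal or adjacent to `x`.
  rcases hz with ⟨hz, z', hz'⟩ | hz
  · right
    refine ncard_le_ncard_of_subsingleton
      (fun y hy y' hy' => (hz y hy.1).trans (hz y' hy'.1).symm)
      ⟨z', hz', iff_of_false (fun h => ?_) hxz, iff_of_false (fun h => ?_) hadj⟩
    · exact hxz (hz x (by rw [hx, h, hz']))
    · obtain ⟨z1, h1, h2⟩ := hback z' h
      exact hadj (hz z1 (h2.trans hz') ▸ h1)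
  · left
    -- Removing `x'` and its at most two neighbours from a class of `c + 3` nodes leaves `c`.
    have h1 := Set.le_ncard_sdiff (insert x' {y | H.Adj x' y}) {y | col' y = col z}
    have h2 := Set.ncard_insert_le x' {y | H.Adj x' y}
    refine le_trans (by omega) (h1.trans (Set.ncard_le_ncard (fun y hy => ?_) (Set.toFinite _)))
    simp only [Set.mem_sdiff, Set.mem_insert_iff, Set.mem_ofPred_eq, not_or] at hy ⊢
    exact ⟨hy.1, iff_of_false (fun h => hy.2.1 h.symm) hxz, iff_of_false hy.2.2 hadj⟩

/-! ### Gadgetisations with a twist -/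

/-- The strict linear order on `Fin N`. -/
def linearGraph (N : ℕ) : LGraph 0 := graphOn 0 N (fun i j => i < j) fun i => lt_irrefl i

theorem linearGraph_isStrictLinearOrder (N : ℕ) : (linearGraph N).IsStrictLinearOrder :=
  ⟨(linearGraph N).loopless, fun i j => by
    rcases lt_trichotomy (α := Fin N) i j with h | h | h
    exacts [Or.inr (Or.inl h), Or.inl h, Or.inr (Or.inr h)], fun _ _ _ => lt_trans (α := Fin N)⟩

/-- The steps of the gadget paths, with the second halves of the paths permuted by `σ`. -/
def TwistStep (G : LGraph d) (σ : Equiv.Perm G.Edge) : GadNode G → GadNode G → Prop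
  | .node1 u, .node2 e => e.1.1 = u
  | .node2 e, .node3 f => f = σ e
  | .node3 e, .node1 w => e.1.2 = w
  | _, _ => False

/-- The gadgetisation with the second halves of the gadget paths permuted by `σ`. -/
def twistedGad (G : LGraph d) (σ : Equiv.Perm G.Edge) : LGraph 3 where
  V := GadNode G
  Adj a b := TwistStep G σ a b ∨ TwistStep G σ b a
  loopless v := by cases v <;> simp [TwistStep]
  label := gadLabel G

theorem twistedGad_isUndirected (G : LGraph d) (σ : Equiv.Perm G.Edge) :
    (twistedGad G σ).IsUndirected := fun _ _ h => h.symm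

/-- The recursive form of `TwistStep` lets `simp` evaluate adjacency in `gad` case by case. -/
theorem twistStep_one_iff (G : LGraph d) (a b : GadNode G) :
    TwistStep G 1 a b ↔ GadStep G a b := by
  constructor
  · intro h
    cases a <;> cases b <;> simp only [TwistStep] at h
    · exact h ▸ .step12 _
    · rw [h]
      exact .step23 _
    · exact h ▸ .step31 _
  · rintro (e | e | e) <;> simp [TwistStep]

theorem twistedGad_one_isomorphic (G : LGraph d) : (twistedGad G 1).Isomorphic (gad G) :=
  ⟨Equiv.refl _, fun u v => or_congr (twistStep_one_iff G u v) (twistStep_one_iff G v u),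
    fun _ => rfl⟩

/-- Equal kinds are never adjacent, so a triangle has one node of each kind; its second and third
nodes belong to one edge, whose source and target would coincide. -/
theorem gad_not_triangle (G : LGraph d) (a b c : GadNode G) (hab : (gad G).Adj a b)
    (hbc : (gad G).Adj b c) (hca : (gad G).Adj c a) : False := by
  simp only [gad, ← twistStep_one_iff] at hab hbc hca
  have hne : ∀ e : G.Edge, e.1.1 ≠ e.1.2 := fun e h => G.loopless e.1.2 (by
    have := e.2
    rwa [h] at this)
  cases a <;> cases b <;> cases c <;> simp [TwistStep] at hab hbc hca <;> subst_vars <;>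
    first
    | exact hne _ hab
    | exact hne _ hab.symm
    | exact hne _ hbc
    | exact hne _ hbc.symm
    | exact hne _ hca
    | exact hne _ hca.symm

/-! ### Colour classes of edges of a linear order -/

section LinearEdges

variable {N c q : ℕ}

/-- A node of the linear order, as a number. -/
def nodePos (i : (linearGraph N).V) : ℕ := Fin.val (n := N) i

theorem nodePos_lt (i : (linearGraph N).V) : nodePos i < N := Fin.isLt (n := N) i

theorem nodePos_injective : Function.Injective (nodePos (N := N)) := Fin.val_injective

theorem exists_node {n : ℕ} (h : n < N) : ∃ i : (linearGraph N).V, nodePos i = n :=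
  ⟨(⟨n, h⟩ : Fin N), rfl⟩

/-- The source of an edge, as a number. -/
def edgeSrc (e : (linearGraph N).Edge) : ℕ := nodePos e.1.1

/-- The target of an edge, as a number. -/
def edgeTgt (e : (linearGraph N).Edge) : ℕ := nodePos e.1.2

theorem edgeSrc_lt_edgeTgt (e : (linearGraph N).Edge) : edgeSrc e < edgeTgt e := e.2

theorem edgeTgt_lt (e : (linearGraph N).Edge) : edgeTgt e < N := nodePos_lt _

theorem edgeSrc_lt (e : (linearGraph N).Edge) : edgeSrc e < N :=
  (edgeSrc_lt_edgeTgt e).trans (edgeTgt_lt e)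

theorem edge_ext {e f : (linearGraph N).Edge} (h : edgeSrc e = edgeSrc f)
    (h' : edgeTgt e = edgeTgt f) : e = f :=
  Subtype.ext (Prod.ext (nodePos_injective h) (nodePos_injective h'))

theorem exists_edge {i j : ℕ} (h : i < j) (hj : j < N) :
    ∃ e : (linearGraph N).Edge, edgeSrc e = i ∧ edgeTgt e = j :=
  ⟨⟨((⟨i, h.trans hj⟩ : Fin N), (⟨j, hj⟩ : Fin N)), h⟩, rfl, rfl⟩

/-- The endpoints of the edges have the same colours. -/
def SameColours (c q : ℕ) (e f : (linearGraph N).Edge) : Prop :=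
  posColour N c q (edgeSrc e) = posColour N c q (edgeSrc f) ∧
  posColour N c q (edgeTgt e) = posColour N c q (edgeTgt f)

theorem sameColours_iff {e f : (linearGraph N).Edge} : SameColours c q e f ↔
    ((IsMiddle N c q (edgeSrc e) ∧ IsMiddle N c q (edgeSrc f)) ∨ edgeSrc e = edgeSrc f) ∧
    ((IsMiddle N c q (edgeTgt e) ∧ IsMiddle N c q (edgeTgt f)) ∨ edgeTgt e = edgeTgt f) := by
  unfold SameColours
  rw [posColour_eq_iff (edgeSrc_lt e) (edgeSrc_lt f), posColour_eq_iff (edgeTgt_lt e) (edgeTgt_lt f)]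

theorem SameColours.eq_of_not_middle {e f : (linearGraph N).Edge} (h : SameColours c q e f)
    (hs : ¬ IsMiddle N c q (edgeSrc f)) (ht : ¬ IsMiddle N c q (edgeTgt f)) : e = f := by
  rw [sameColours_iff] at h
  exact edge_ext (h.1.resolve_left fun h => hs h.2) (h.2.resolve_left fun h => ht h.2)

/-- A target `w` of the right colour is fixed as far right as needed, and the source runs through
the middle positions before `N - q * c - 1`. The summand `5` in `hN` pays for the required `3`, the
position kept for the target, and the excluded source `i`. -/
theorem le_ncard_src_ne (hN : 2 * (q * c) + c + 5 ≤ N) (e : (linearGraph N).Edge)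
    (h : IsMiddle N c q (edgeSrc e)) (i : ℕ) :
    c + 3 ≤ {f | SameColours c q f e ∧ edgeSrc f ≠ i}.ncard := by
  have hlt := edgeSrc_lt_edgeTgt e
  have hlt' := edgeTgt_lt e
  obtain ⟨w, hw, hwN, hw'⟩ : ∃ w, N - q * c - 1 ≤ w ∧ w < N ∧
      ((IsMiddle N c q w ∧ IsMiddle N c q (edgeTgt e)) ∨ w = edgeTgt e) := by
    by_cases ht : IsMiddle N c q (edgeTgt e)
    · exact ⟨N - q * c - 1, le_rfl, by omega, Or.inl ⟨⟨by omega, by omega⟩, ht⟩⟩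
    · refine ⟨edgeTgt e, ?_, hlt', Or.inr rfl⟩
      unfold IsMiddle at h ht
      omega
  refine le_trans ?_ (card_le_ncard_of_keys ((Finset.Ico (q * c) (N - q * c - 1)).erase i) edgeSrc
    fun n hn => ?_)
  · have := Finset.pred_card_le_card_erase (s := Finset.Ico (q * c) (N - q * c - 1)) (a := i)
    rw [Nat.card_Ico] at this
    omega
  · rw [Finset.mem_erase, Finset.mem_Ico] at hn
    obtain ⟨f, rfl, rfl⟩ := exists_edge (N := N) (i := n) (j := w) (by omega) hwN
    exact ⟨f, ⟨sameColours_iff.2 ⟨Or.inl ⟨⟨by omega, by omega⟩, h⟩, hw'⟩, hn.1⟩, rfl⟩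

theorem le_ncard_tgt_ne (hN : 2 * (q * c) + c + 5 ≤ N) (e : (linearGraph N).Edge)
    (h : IsMiddle N c q (edgeTgt e)) (i : ℕ) :
    c + 3 ≤ {f | SameColours c q f e ∧ edgeTgt f ≠ i}.ncard := by
  have hlt := edgeSrc_lt_edgeTgt e
  obtain ⟨w, hw, hw'⟩ : ∃ w, w ≤ q * c ∧
      ((IsMiddle N c q w ∧ IsMiddle N c q (edgeSrc e)) ∨ w = edgeSrc e) := by
    by_cases ht : IsMiddle N c q (edgeSrc e)
    · exact ⟨q * c, le_rfl, Or.inl ⟨⟨by omega, by omega⟩, ht⟩⟩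
    · refine ⟨edgeSrc e, ?_, Or.inr rfl⟩
      unfold IsMiddle at h ht
      omega
  refine le_trans ?_ (card_le_ncard_of_keys ((Finset.Ico (q * c + 1) (N - q * c)).erase i) edgeTgt
    fun n hn => ?_)
  · have := Finset.pred_card_le_card_erase (s := Finset.Ico (q * c + 1) (N - q * c)) (a := i)
    rw [Nat.card_Ico] at this
    omega
  · rw [Finset.mem_erase, Finset.mem_Ico] at hn
    obtain ⟨f, rfl, rfl⟩ := exists_edge (N := N) (i := w) (j := n) (by omega) (by omega)
    exact ⟨f, ⟨sameColours_iff.2 ⟨hw', Or.inl ⟨⟨by omega, by omega⟩, h⟩⟩, hn.1⟩, rfl⟩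

theorem eq_or_le_ncard_sameColours (hN : 2 * (q * c) + c + 5 ≤ N) (e : (linearGraph N).Edge) :
    (∀ f, SameColours c q f e → f = e) ∨ c + 3 ≤ {f | SameColours c q f e}.ncard := by
  by_cases hs : IsMiddle N c q (edgeSrc e)
  -- No edge has source `N`, so this choice of the excluded position excludes nothing.
  · exact Or.inr ((le_ncard_src_ne hN e hs N).trans
      (Set.ncard_le_ncard (fun f hf => hf.1) (Set.toFinite _)))
  by_cases ht : IsMiddle N c q (edgeTgt e)
  · exact Or.inr ((le_ncard_tgt_ne hN e ht N).trans
      (Set.ncard_le_ncard (fun f hf => hf.1) (Set.toFinite _)))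
  exact Or.inl fun f hf => hf.eq_of_not_middle hs ht

/-- This is the count of second-kind neighbours and non-neighbours of a first-kind node. The
critical case is `edgeSrc e = i`: if the target of `e` is in the middle, `i'` has edges to the last
`c` middle positions; otherwise that target is to the right of the middle and gives exactly one edge
from `i'`. -/
theorem count_src (hN : 2 * (q * c) + c + 5 ≤ N) {i i' : ℕ} (hi : i < N) (hi' : i' < N)
    (h : posColour N c (q + 1) i = posColour N c (q + 1) i') (e : (linearGraph N).Edge) :
    c ≤ {f | SameColours c q f e ∧ (edgeSrc f = i' ↔ edgeSrc e = i)}.ncard ∨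
    {f | SameColours c q f e ∧ (edgeSrc f = i ↔ edgeSrc e = i)}.ncard ≤
      {f | SameColours c q f e ∧ (edgeSrc f = i' ↔ edgeSrc e = i)}.ncard := by
  rcases (posColour_eq_iff hi hi').1 h with ⟨hm, hm'⟩ | rfl
  swap
  · exact Or.inr le_rfl
  have hlt := edgeSrc_lt_edgeTgt e
  have hlt' := edgeTgt_lt e
  have hq := hm.of_succ
  have hq' := hm'.of_succ
  by_cases hs : IsMiddle N c q (edgeSrc e)
  swap
  · right
    refine Set.ncard_le_ncard (fun f hf => ⟨hf.1, iff_of_false ?_ ?_⟩) (Set.toFinite _)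
    · have := (sameColours_iff.1 hf.1).1.resolve_left fun h => hs h.2
      intro h
      rw [← this, h] at hs
      exact hs hq'
    · intro h
      rw [h] at hs
      exact hs hq
  by_cases hei : edgeSrc e = i
  swap
  · left
    refine le_trans (by omega) ((le_ncard_src_ne hN e hs i').trans
      (Set.ncard_le_ncard (fun f hf => ⟨hf.1, iff_of_false hf.2 hei⟩) (Set.toFinite _)))
  by_cases ht : IsMiddle N c q (edgeTgt e)
  · left
    unfold IsMiddle at hm'
    rw [add_mul, one_mul] at hm'
    refine le_trans ?_ (card_le_ncard_of_keys (Finset.Ico (N - q * c - c) (N - q * c)) edgeTgt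
      fun n hn => ?_)
    · rw [Nat.card_Ico]
      omega
    · rw [Finset.mem_Ico] at hn
      obtain ⟨f, hf, rfl⟩ := exists_edge (N := N) (i := i') (j := n) (by omega) (by omega)
      exact ⟨f, ⟨sameColours_iff.2 ⟨Or.inl ⟨hf ▸ hq', hs⟩, Or.inl ⟨⟨by omega, by omega⟩, ht⟩⟩,
        iff_of_true hf hei⟩, rfl⟩
  · right
    refine ncard_le_ncard_of_subsingleton (fun f hf f' hf' => ?_) ?_
    · refine edge_ext ((hf.2.2 hei).trans (hf'.2.2 hei).symm) ?_
      exact ((sameColours_iff.1 hf.1).2.resolve_left fun h => ht h.2).trans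
        ((sameColours_iff.1 hf'.1).2.resolve_left fun h => ht h.2).symm
    · obtain ⟨f, hf, hft⟩ := exists_edge (N := N) (i := i') (j := edgeTgt e) (by
        unfold IsMiddle at hs hq' ht
        omega) hlt'
      exact ⟨f, sameColours_iff.2 ⟨Or.inl ⟨hf ▸ hq', hs⟩, Or.inr hft⟩, iff_of_true hf hei⟩

/-- Mirror image of `count_src`: the first `c` middle positions serve as sources of edges into `i'`.
-/
theorem count_tgt (hN : 2 * (q * c) + c + 5 ≤ N) {i i' : ℕ} (hi : i < N) (hi' : i' < N)
    (h : posColour N c (q + 1) i = posColour N c (q + 1) i') (e : (linearGraph N).Edge) :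
    c ≤ {f | SameColours c q f e ∧ (edgeTgt f = i' ↔ edgeTgt e = i)}.ncard ∨
    {f | SameColours c q f e ∧ (edgeTgt f = i ↔ edgeTgt e = i)}.ncard ≤
      {f | SameColours c q f e ∧ (edgeTgt f = i' ↔ edgeTgt e = i)}.ncard := by
  rcases (posColour_eq_iff hi hi').1 h with ⟨hm, hm'⟩ | rfl
  swap
  · exact Or.inr le_rfl
  have hlt := edgeSrc_lt_edgeTgt e
  have hlt' := edgeTgt_lt e
  have hq := hm.of_succ
  have hq' := hm'.of_succ
  by_cases ht : IsMiddle N c q (edgeTgt e)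
  swap
  · right
    refine Set.ncard_le_ncard (fun f hf => ⟨hf.1, iff_of_false ?_ ?_⟩) (Set.toFinite _)
    · have := (sameColours_iff.1 hf.1).2.resolve_left fun h => ht h.2
      intro h
      rw [← this, h] at ht
      exact ht hq'
    · intro h
      rw [h] at ht
      exact ht hq
  by_cases hei : edgeTgt e = i
  swap
  · left
    refine le_trans (by omega) ((le_ncard_tgt_ne hN e ht i').trans
      (Set.ncard_le_ncard (fun f hf => ⟨hf.1, iff_of_false hf.2 hei⟩) (Set.toFinite _)))
  by_cases hs : IsMiddle N c q (edgeSrc e)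
  · left
    unfold IsMiddle at hm'
    rw [add_mul, one_mul] at hm'
    refine le_trans ?_ (card_le_ncard_of_keys (Finset.Ico (q * c) (q * c + c)) edgeSrc
      fun n hn => ?_)
    · rw [Nat.card_Ico]
      omega
    · rw [Finset.mem_Ico] at hn
      obtain ⟨f, rfl, hf⟩ := exists_edge (N := N) (i := n) (j := i') (by omega) (by omega)
      exact ⟨f, ⟨sameColours_iff.2 ⟨Or.inl ⟨⟨by omega, by omega⟩, hs⟩, Or.inl ⟨hf ▸ hq', ht⟩⟩,
        iff_of_true hf hei⟩, rfl⟩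
  · right
    refine ncard_le_ncard_of_subsingleton (fun f hf f' hf' => ?_) ?_
    · refine edge_ext ?_ ((hf.2.2 hei).trans (hf'.2.2 hei).symm)
      exact ((sameColours_iff.1 hf.1).1.resolve_left fun h => hs h.2).trans
        ((sameColours_iff.1 hf'.1).1.resolve_left fun h => hs h.2).symm
    · obtain ⟨f, hft, hf⟩ := exists_edge (N := N) (i := edgeSrc e) (j := i') (by
        unfold IsMiddle at ht hq' hs
        omega) hi'
      exact ⟨f, sameColours_iff.2 ⟨Or.inr hft, Or.inl ⟨hf ▸ hq', ht⟩⟩, iff_of_true hf hei⟩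

end LinearEdges

/-! ### Gadgetisations of linear orders are not recognised by `C²` -/

/-- The colour of a node of the gadgetisation of a linear order: its kind and the colours of the
positions that it comes from. -/
noncomputable def gadColour (N c q : ℕ) : GadNode (linearGraph N) → ℕ × ℕ × ℕ
  | .node1 i => (1, posColour N c q (nodePos i), 0)
  | .node2 e => (2, posColour N c q (edgeSrc e), posColour N c q (edgeTgt e))
  | .node3 e => (3, posColour N c q (edgeSrc e), posColour N c q (edgeTgt e))

theorem gadColour_of_succ {N c q : ℕ} {x y : GadNode (linearGraph N)}
    (h : gadColour N c (q + 1) x = gadColour N c (q + 1) y) :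
    gadColour N c q x = gadColour N c q y := by
  cases x <;> cases y <;> simp [gadColour] at h ⊢
  · exact posColour_of_succ (nodePos_lt _) (nodePos_lt _) h
  · exact ⟨posColour_of_succ (edgeSrc_lt _) (edgeSrc_lt _) h.1,
      posColour_of_succ (edgeTgt_lt _) (edgeTgt_lt _) h.2⟩
  · exact ⟨posColour_of_succ (edgeSrc_lt _) (edgeSrc_lt _) h.1,
      posColour_of_succ (edgeTgt_lt _) (edgeTgt_lt _) h.2⟩

theorem gadLabel_eq_of_gadColour_eq {N c q : ℕ} {x y : GadNode (linearGraph N)}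
    (h : gadColour N c q x = gadColour N c q y) :
    gadLabel (linearGraph N) x = gadLabel (linearGraph N) y := by
  cases x <;> cases y <;> simp [gadColour, gadLabel] at h ⊢

theorem node1_injective (G : LGraph d) : Function.Injective (GadNode.node1 (G := G)) :=
  fun _ _ h => by injection h

theorem node2_injective (G : LGraph d) : Function.Injective (GadNode.node2 (G := G)) :=
  fun _ _ h => by injection h

theorem node3_injective (G : LGraph d) : Function.Injective (GadNode.node3 (G := G)) :=
  fun _ _ h => by injection h

theorem le_ncard_node_ne {N c q : ℕ} (hN : 2 * (q * c) + c + 5 ≤ N) {j : (linearGraph N).V}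
    (hj : IsMiddle N c q (nodePos j)) (i : ℕ) :
    c + 3 ≤ {k : (linearGraph N).V | posColour N c q (nodePos k) = posColour N c q (nodePos j) ∧
      nodePos k ≠ i}.ncard := by
  refine le_trans ?_ (card_le_ncard_of_keys ((Finset.Ico (q * c) (N - q * c)).erase i)
    nodePos fun n hn => ?_)
  · have := Finset.pred_card_le_card_erase (s := Finset.Ico (q * c) (N - q * c)) (a := i)
    rw [Nat.card_Ico] at this
    omega
  · rw [Finset.mem_erase, Finset.mem_Ico] at hn
    obtain ⟨k, rfl⟩ := exists_node (N := N) (n := n) (by omega)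
    exact ⟨k, ⟨(posColour_eq_iff (nodePos_lt _) (nodePos_lt _)).2
      (Or.inl ⟨⟨hn.2.1, by omega⟩, hj⟩), hn.1⟩, rfl⟩

theorem gadColour_rigid_or_large {N c q : ℕ} (hN : 2 * (q * c) + c + 5 ≤ N)
    (z : GadNode (linearGraph N)) :
    (∀ y, gadColour N c q y = gadColour N c q z → y = z) ∨
      c + 3 ≤ {y | gadColour N c q y = gadColour N c q z}.ncard := by
  cases z with
  | node1 j =>
    by_cases hj : IsMiddle N c q (nodePos j)
    · right
      refine (le_ncard_node_ne hN hj N).trans ?_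
      rw [← Set.ncard_image_of_injective _ (node1_injective _)]
      refine Set.ncard_le_ncard ?_ (Set.toFinite _)
      rintro _ ⟨k, hk, rfl⟩
      simp only [Set.mem_ofPred_eq, gadColour, hk.1]
    · left
      intro y hy
      cases y <;> simp [gadColour] at hy
      rw [posColour_eq_iff (nodePos_lt _) (nodePos_lt _)] at hy
      exact congrArg _ (nodePos_injective (hy.resolve_left fun h => hj h.2))
  | node2 e =>
    refine (eq_or_le_ncard_sameColours hN e).imp (fun h y hy => ?_) fun h => h.trans ?_
    · cases y <;> simp [gadColour] at hy
      exact congrArg _ (h _ hy)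
    · rw [← Set.ncard_image_of_injective _ (node2_injective _)]
      refine Set.ncard_le_ncard ?_ (Set.toFinite _)
      rintro _ ⟨k, hk, rfl⟩
      simpa [gadColour, SameColours] using hk
  | node3 e =>
    refine (eq_or_le_ncard_sameColours hN e).imp (fun h y hy => ?_) fun h => h.trans ?_
    · cases y <;> simp [gadColour] at hy
      exact congrArg _ (h _ hy)
    · rw [← Set.ncard_image_of_injective _ (node3_injective _)]
      refine Set.ncard_le_ncard ?_ (Set.toFinite _)
      rintro _ ⟨k, hk, rfl⟩
      simpa [gadColour, SameColours] using hk

theorem ncard_node_setOf {G : LGraph d} {P : GadNode G → Prop} {α : Type} {f : α → GadNode G}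
    (hf : Function.Injective f) (hP : ∀ y, P y → ∃ x, f x = y) :
    {y | P y}.ncard = {x | P (f x)}.ncard := by
  rw [← Set.ncard_image_of_injective _ hf]
  congr 1
  ext y
  refine ⟨fun hy => ?_, ?_⟩
  · obtain ⟨x, rfl⟩ := hP y hy
    exact ⟨x, hy, rfl⟩
  · rintro ⟨x, hx, rfl⟩
    exact hx

/-- The permutation does not affect edges at first-kind nodes, so the counts reduce to positions, to
edges by source, and to edges by target. -/
theorem count_node1 {N c q : ℕ} (hN : 2 * (q * c) + c + 5 ≤ N)
    (σ τ : Equiv.Perm (linearGraph N).Edge) {i i' : (linearGraph N).V}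
    (h : posColour N c (q + 1) (nodePos i) = posColour N c (q + 1) (nodePos i'))
    (z : GadNode (linearGraph N)) :
    c ≤ {y | pairType (twistedGad _ τ) (gadColour N c q) (.node1 i') y =
        pairType (twistedGad _ σ) (gadColour N c q) (.node1 i) z}.ncard ∨
    {y | pairType (twistedGad _ σ) (gadColour N c q) (.node1 i) y =
        pairType (twistedGad _ σ) (gadColour N c q) (.node1 i) z}.ncard ≤
      {y | pairType (twistedGad _ τ) (gadColour N c q) (.node1 i') y =
        pairType (twistedGad _ σ) (gadColour N c q) (.node1 i) z}.ncard := by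
  have key : ∀ (ρ : Equiv.Perm (linearGraph N).Edge) (k : (linearGraph N).V) (y),
      pairType (twistedGad _ ρ) (gadColour N c q) (.node1 k) y =
        pairType (twistedGad _ σ) (gadColour N c q) (.node1 i) z ↔
      gadColour N c q y = gadColour N c q z ∧ (GadNode.node1 k = y ↔ GadNode.node1 i = z) ∧
        ((twistedGad _ ρ).Adj (.node1 k) y ↔ (twistedGad _ σ).Adj (.node1 i) z) := fun ρ k y =>
    pairType_eq_iff (twistedGad_isUndirected _ σ) (twistedGad_isUndirected _ ρ)
  simp only [key]
  have hinj := fun {a b : (linearGraph N).V} => (nodePos_injective (N := N)).eq_iff (a := a) (b := b)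
  cases z with
  | node1 j =>
    have hnode : ∀ (ρ : Equiv.Perm (linearGraph N).Edge) (k : (linearGraph N).V),
        {y | gadColour N c q y = gadColour N c q (.node1 j) ∧
          (GadNode.node1 k = y ↔ GadNode.node1 i = GadNode.node1 j) ∧
          ((twistedGad _ ρ).Adj (.node1 k) y ↔ (twistedGad _ σ).Adj (.node1 i) (.node1 j))}.ncard =
        {a | posColour N c q (nodePos a) = posColour N c q (nodePos j) ∧ (k = a ↔ i = j)}.ncard := by
      intro ρ k
      rw [ncard_node_setOf (node1_injective _) fun y hy => ?_]
      · simp [gadColour, twistedGad, TwistStep]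
      · cases y <;> simp [gadColour] at hy ⊢
    erw [hnode, hnode]
    by_cases hij : i = j
    · subst hij
      right
      refine ncard_le_ncard_of_subsingleton (fun y hy y' hy' => ?_) ⟨i', ?_⟩
      · exact (hy.2.2 rfl).symm.trans (hy'.2.2 rfl)
      · exact ⟨(posColour_of_succ (nodePos_lt _) (nodePos_lt _) h).symm, by simp⟩
    by_cases hj : IsMiddle N c q (nodePos j)
    · left
      refine le_trans (by omega) ((le_ncard_node_ne hN hj (nodePos i')).trans
        (Set.ncard_le_ncard (fun k hk => ⟨hk.1, iff_of_false ?_ hij⟩) (Set.toFinite _)))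
      rintro rfl
      exact hk.2 rfl
    · right
      have hrigid : ∀ k : (linearGraph N).V,
          posColour N c q (nodePos k) = posColour N c q (nodePos j) → k = j := fun k hk =>
        nodePos_injective (((posColour_eq_iff (nodePos_lt _) (nodePos_lt _)).1 hk).resolve_left
          fun h => hj h.2)
      refine ncard_le_ncard_of_subsingleton
        (fun y hy y' hy' => (hrigid y hy.1).trans (hrigid y' hy'.1).symm)
        ⟨j, rfl, iff_of_false ?_ hij⟩
      rintro rfl
      exact hij (hrigid i (posColour_of_succ (nodePos_lt _) (nodePos_lt _) h))
  | node2 e =>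
    have hnode : ∀ (ρ : Equiv.Perm (linearGraph N).Edge) (k : (linearGraph N).V),
        {y | gadColour N c q y = gadColour N c q (.node2 e) ∧
          (GadNode.node1 k = y ↔ GadNode.node1 i = GadNode.node2 e) ∧
          ((twistedGad _ ρ).Adj (.node1 k) y ↔ (twistedGad _ σ).Adj (.node1 i) (.node2 e))}.ncard =
        {f | SameColours c q f e ∧ (edgeSrc f = nodePos k ↔ edgeSrc e = nodePos i)}.ncard := by
      intro ρ k
      rw [ncard_node_setOf (node2_injective _) fun y hy => ?_]
      · simp [gadColour, twistedGad, TwistStep, SameColours, edgeSrc, hinj]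
      · cases y <;> simp [gadColour] at hy ⊢
    erw [hnode, hnode]
    exact count_src hN (nodePos_lt _) (nodePos_lt _) h e
  | node3 e =>
    have hnode : ∀ (ρ : Equiv.Perm (linearGraph N).Edge) (k : (linearGraph N).V),
        {y | gadColour N c q y = gadColour N c q (.node3 e) ∧
          (GadNode.node1 k = y ↔ GadNode.node1 i = GadNode.node3 e) ∧
          ((twistedGad _ ρ).Adj (.node1 k) y ↔ (twistedGad _ σ).Adj (.node1 i) (.node3 e))}.ncard =
        {f | SameColours c q f e ∧ (edgeTgt f = nodePos k ↔ edgeTgt e = nodePos i)}.ncard := by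
      intro ρ k
      rw [ncard_node_setOf (node3_injective _) fun y hy => ?_]
      · simp [gadColour, twistedGad, TwistStep, SameColours, edgeTgt, hinj]
      · cases y <;> simp [gadColour] at hy ⊢
    erw [hnode, hnode]
    exact count_tgt hN (nodePos_lt _) (nodePos_lt _) h e

/-- The permutation preserves the colours of edges up to level `Q`. -/
def PreservesColours {N : ℕ} (c Q : ℕ) (σ : Equiv.Perm (linearGraph N).Edge) : Prop :=
  ∀ q ≤ Q, ∀ e, SameColours c q (σ e) e

theorem PreservesColours.symm {N c Q : ℕ} {σ : Equiv.Perm (linearGraph N).Edge}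
    (h : PreservesColours c Q σ) : PreservesColours c Q σ.symm := fun q hq e => by
  have := h q hq (σ.symm e)
  rw [Equiv.apply_symm_apply] at this
  exact ⟨this.1.symm, this.2.symm⟩

theorem twistedGad_adj_node2_iff {N : ℕ} (σ : Equiv.Perm (linearGraph N).Edge)
    (e : (linearGraph N).Edge) (y : GadNode (linearGraph N)) :
    (twistedGad _ σ).Adj (.node2 e) y ↔ y = .node1 e.1.1 ∨ y = .node3 (σ e) := by
  cases y <;> simp [twistedGad, TwistStep, eq_comm]

theorem twistedGad_adj_node3_iff {N : ℕ} (σ : Equiv.Perm (linearGraph N).Edge)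
    (e : (linearGraph N).Edge) (y : GadNode (linearGraph N)) :
    (twistedGad _ σ).Adj (.node3 e) y ↔ y = .node1 e.1.2 ∨ y = .node2 (σ.symm e) := by
  cases y <;> simp [twistedGad, TwistStep, eq_comm, Equiv.eq_symm_apply]

/-- Nodes of the second and third kind have two neighbours, of different kinds, and the permutations
preserve the neighbours' colours. So `count_of_few_neighbours` applies to them; first-kind nodes are
the business of `count_node1`. -/
theorem countsExtend_twistedGad {N c Q : ℕ} (hN : 2 * (Q * c) + c + 5 ≤ N)
    {σ τ : Equiv.Perm (linearGraph N).Edge} (hσ : PreservesColours c Q σ)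
    (hτ : PreservesColours c Q τ) :
    CountsExtend (twistedGad _ σ) (twistedGad _ τ) (gadColour N c) (gadColour N c) c Q := by
  intro q hq (x : GadNode (linearGraph N)) (x' : GadNode (linearGraph N)) hx
    (z : GadNode (linearGraph N))
  have hNq : 2 * (q * c) + c + 5 ≤ N := by
    have := Nat.mul_le_mul_right c hq.le
    omega
  have hcol := gadColour_of_succ hx
  have hz : ((∀ y, gadColour N c q y = gadColour N c q z → y = z) ∧
      ∃ z', gadColour N c q z' = gadColour N c q z) ∨
      c + 3 ≤ {y | gadColour N c q y = gadColour N c q z}.ncard :=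
    (gadColour_rigid_or_large hNq z).imp_left fun h => ⟨h, z, rfl⟩
  have hpair : ∀ a b : GadNode (linearGraph N), ({a, b} : Set _).ncard ≤ 2 := fun a b =>
    (Set.ncard_insert_le _ _).trans (by rw [Set.ncard_singleton])
  have hU := twistedGad_isUndirected (linearGraph N)
  cases x with
  | node1 i =>
    cases x' <;> simp [gadColour] at hx
    exact count_node1 hNq σ τ hx z
  | node2 e =>
    cases x' <;> simp [gadColour] at hx
    rename_i e'
    have hee : SameColours c q e e' := by simpa [gadColour, SameColours] using hcol
    have h3 : gadColour N c q (.node3 (τ e')) = gadColour N c q (.node3 (σ e)) := by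
      have h1 := hσ q hq.le e
      have h2 := hτ q hq.le e'
      simp [gadColour, h1.1, h1.2, h2.1, h2.2, hee.1, hee.2]
    have h1 : gadColour N c q (.node1 e'.1.1) = gadColour N c q (.node1 e.1.1) := by
      simpa [gadColour, edgeSrc] using hee.1.symm
    refine count_of_few_neighbours (hU σ) (hU τ) hcol ?_ ?_ ?_ ?_ z hz
    · intro (y : GadNode (linearGraph N)) (y' : GadNode (linearGraph N)) hy hy' hyy
      rw [twistedGad_adj_node2_iff] at hy hy'
      rcases hy with rfl | rfl <;> rcases hy' with rfl | rfl <;>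
        first
        | rfl
        | simp [gadColour] at hyy
    · intro (y : GadNode (linearGraph N)) hy
      rw [twistedGad_adj_node2_iff] at hy
      rcases hy with rfl | rfl
      · exact ⟨.node1 e'.1.1, (twistedGad_adj_node2_iff _ _ _).2 (Or.inl rfl), h1⟩
      · exact ⟨.node3 (τ e'), (twistedGad_adj_node2_iff _ _ _).2 (Or.inr rfl), h3⟩
    · intro (y : GadNode (linearGraph N)) hy
      rw [twistedGad_adj_node2_iff] at hy
      rcases hy with rfl | rfl
      · exact ⟨.node1 e.1.1, (twistedGad_adj_node2_iff _ _ _).2 (Or.inl rfl), h1.symm⟩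
      · exact ⟨.node3 (σ e), (twistedGad_adj_node2_iff _ _ _).2 (Or.inr rfl), h3.symm⟩
    · exact (Set.ncard_le_ncard (fun y hy => (twistedGad_adj_node2_iff _ _ _).1 hy)
        (Set.toFinite _)).trans (hpair _ _)
  | node3 e =>
    cases x' <;> simp [gadColour] at hx
    rename_i e'
    have hee : SameColours c q e e' := by simpa [gadColour, SameColours] using hcol
    have h3 : gadColour N c q (.node2 (τ.symm e')) = gadColour N c q (.node2 (σ.symm e)) := by
      have h1 := hσ.symm q hq.le e
      have h2 := hτ.symm q hq.le e'
      simp [gadColour, h1.1, h1.2, h2.1, h2.2, hee.1, hee.2]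
    have h1 : gadColour N c q (.node1 e'.1.2) = gadColour N c q (.node1 e.1.2) := by
      simpa [gadColour, edgeTgt] using hee.2.symm
    refine count_of_few_neighbours (hU σ) (hU τ) hcol ?_ ?_ ?_ ?_ z hz
    · intro (y : GadNode (linearGraph N)) (y' : GadNode (linearGraph N)) hy hy' hyy
      rw [twistedGad_adj_node3_iff] at hy hy'
      rcases hy with rfl | rfl <;> rcases hy' with rfl | rfl <;>
        first
        | rfl
        | simp [gadColour] at hyy
    · intro (y : GadNode (linearGraph N)) hy
      rw [twistedGad_adj_node3_iff] at hy
      rcases hy with rfl | rfl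
      · exact ⟨.node1 e'.1.2, (twistedGad_adj_node3_iff _ _ _).2 (Or.inl rfl), h1⟩
      · exact ⟨.node2 (τ.symm e'), (twistedGad_adj_node3_iff _ _ _).2 (Or.inr rfl), h3⟩
    · intro (y : GadNode (linearGraph N)) hy
      rw [twistedGad_adj_node3_iff] at hy
      rcases hy with rfl | rfl
      · exact ⟨.node1 e.1.2, (twistedGad_adj_node3_iff _ _ _).2 (Or.inl rfl), h1.symm⟩
      · exact ⟨.node2 (σ.symm e), (twistedGad_adj_node3_iff _ _ _).2 (Or.inr rfl), h3.symm⟩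
    · exact (Set.ncard_le_ncard (fun y hy => (twistedGad_adj_node3_iff _ _ _).1 hy)
        (Set.toFinite _)).trans (hpair _ _)

theorem phiGadLin_notMem_C2Properties : phiGadLin ∉ C2Properties (undirectedGraphs 3) := by
  classical
  refine notMem_C2Properties fun c Q => ?_
  obtain ⟨N, hN⟩ : ∃ N, N = 2 * (Q * c) + c + 5 := ⟨_, rfl⟩
  -- The consecutive edges `a` and `b` meet at `i`, and all their endpoints are in the middle at
  -- every level up to `Q`. Swapping them therefore preserves colours.
  obtain ⟨a, ha, ha'⟩ := exists_edge (N := N) (i := Q * c) (j := Q * c + 1) (by omega) (by omega)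
  obtain ⟨b, hb, hb'⟩ := exists_edge (N := N) (i := Q * c + 1) (j := Q * c + 2)
    (by omega) (by omega)
  obtain ⟨i, hi⟩ := exists_node (N := N) (n := Q * c + 1) (by omega)
  have hone : PreservesColours (N := N) c Q 1 := fun q _ e => ⟨rfl, rfl⟩
  have hmid : ∀ q ≤ Q, ∀ n, Q * c ≤ n → n ≤ Q * c + 2 → IsMiddle N c q n := by
    intro q hq n h1 h2
    have := Nat.mul_le_mul_right c hq
    exact ⟨by omega, by omega⟩
  have hswap : PreservesColours c Q (Equiv.swap a b) := by
    intro q hq e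
    have hab : ∀ f : (linearGraph N).Edge, f = a ∨ f = b →
        IsMiddle N c q (edgeSrc f) ∧ IsMiddle N c q (edgeTgt f) := by
      rintro f (rfl | rfl)
      · exact ⟨hmid q hq _ (by omega) (by omega), hmid q hq _ (by omega) (by omega)⟩
      · exact ⟨hmid q hq _ (by omega) (by omega), hmid q hq _ (by omega) (by omega)⟩
    have hsame : ∀ f g, f = a ∨ f = b → g = a ∨ g = b → SameColours c q f g := fun f g hf hg =>
      sameColours_iff.2 ⟨Or.inl ⟨(hab f hf).1, (hab g hg).1⟩, Or.inl ⟨(hab f hf).2, (hab g hg).2⟩⟩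
    by_cases hea : e = a
    · subst hea
      rw [Equiv.swap_apply_left]
      exact hsame _ _ (Or.inr rfl) (Or.inl rfl)
    by_cases heb : e = b
    · subst heb
      rw [Equiv.swap_apply_right]
      exact hsame _ _ (Or.inl rfl) (Or.inr rfl)
    rw [Equiv.swap_apply_of_ne_of_ne hea heb]
    exact ⟨rfl, rfl⟩
  refine ⟨ℕ × ℕ × ℕ, twistedGad _ 1, twistedGad _ (Equiv.swap a b), gadColour N c, gadColour N c,
    .node1 i, .node1 i, twistedGad_isUndirected _ _, twistedGad_isUndirected _ _,
    fun q x x' h => gadLabel_eq_of_gadColour_eq h, fun q _ x x' => gadColour_of_succ,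
    countsExtend_twistedGad hN.ge hone hswap, countsExtend_twistedGad hN.ge hswap hone, rfl,
    ⟨0, linearGraph N, linearGraph_isStrictLinearOrder N, twistedGad_one_isomorphic _⟩, ?_⟩
  rintro ⟨k, L, -, f, hf, -⟩
  have hai : a.1.2 = i := nodePos_injective (ha'.trans hi.symm)
  have hbi : b.1.1 = i := nodePos_injective (hb.trans hi.symm)
  -- The swap joins `node2 b` to `node3 a`. The first is adjacent to the source of `b`, the second
  -- to the target of `a`, and both of these are `i`.
  refine gad_not_triangle L (f (.node1 i)) (f (.node2 b)) (f (.node3 a)) ((hf _ _).1 ?_)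
    ((hf _ _).1 ?_) ((hf _ _).1 ?_)
  · exact (twistedGad_isUndirected _ _) _ _
      ((twistedGad_adj_node2_iff _ _ _).2 (Or.inl (by rw [hbi])))
  · exact (twistedGad_adj_node2_iff _ _ _).2 (Or.inr (by rw [Equiv.swap_apply_right]))
  · exact (twistedGad_adj_node3_iff _ _ _).2 (Or.inl (by rw [hai]))

/-! ### Axioms for gadgetisations -/

/-- The local properties of gadgetisations: every node has exactly one label, adjacent nodes have
different labels, and nodes with the second or third label have exactly one neighbour with each of
the other two labels. -/
def IsGadgetLike (G : LGraph 3) : Prop :=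
  (∀ v, (G.label v 0 = true ∨ G.label v 1 = true ∨ G.label v 2 = true) ∧
    ¬ (G.label v 0 = true ∧ G.label v 1 = true) ∧ ¬ (G.label v 0 = true ∧ G.label v 2 = true) ∧
    ¬ (G.label v 1 = true ∧ G.label v 2 = true)) ∧
  (∀ v w, G.Adj v w → ¬ (G.label v 0 = true ∧ G.label w 0 = true) ∧
    ¬ (G.label v 1 = true ∧ G.label w 1 = true) ∧ ¬ (G.label v 2 = true ∧ G.label w 2 = true)) ∧
  (∀ v, G.label v 1 = true →
    (∃! w, G.Adj v w ∧ G.label w 0 = true) ∧ ∃! w, G.Adj v w ∧ G.label w 2 = true) ∧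
  ∀ v, G.label v 2 = true →
    (∃! w, G.Adj v w ∧ G.label w 0 = true) ∧ ∃! w, G.Adj v w ∧ G.label w 1 = true

/-- The nodes `u, e, f, w` form a gadget path from `u` to `w`. -/
def EdgePath (G : LGraph 3) (u e f w : G.V) : Prop :=
  G.label u 0 = true ∧ G.label e 1 = true ∧ G.label f 2 = true ∧ G.label w 0 = true ∧
    G.Adj u e ∧ G.Adj e f ∧ G.Adj f w

/-- Some gadget path leads from `u` to `w`. -/
def GadReach (G : LGraph 3) (u w : G.V) : Prop := ∃ e f, EdgePath G u e f w

/-- First-order axioms for gadgetisations of strict linear orders. -/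
def IsLinearGadget (G : LGraph 3) : Prop :=
  IsGadgetLike G ∧
  (∀ u w, G.label u 0 = true → G.label w 0 = true → u = w ∨ GadReach G u w ∨ GadReach G w u) ∧
  (∀ u, ¬ GadReach G u u) ∧
  (∀ u v w, GadReach G u v → GadReach G v w → GadReach G u w) ∧
  ∀ u e f w e' f', EdgePath G u e f w → EdgePath G u e' f' w → e = e'

theorem gad_adj_iff {L : LGraph d} {a b : GadNode L} :
    (gad L).Adj a b ↔ TwistStep L 1 a b ∨ TwistStep L 1 b a :=
  or_congr (twistStep_one_iff L a b).symm (twistStep_one_iff L b a).symm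

/-- The order is `GadReach` on the nodes with the first label, and a chosen gadget path realises
each of its edges. The local axioms put every other node on some gadget path, and path uniqueness
makes it the chosen one. -/
theorem IsLinearGadget.exists_isomorphic {G : LGraph 3} (hG : G.IsUndirected)
    (h : IsLinearGadget G) :
    ∃ (k : ℕ) (L : LGraph k), L.IsStrictLinearOrder ∧ G.Isomorphic (gad L) := by
  obtain ⟨⟨hlab, hadj, h1, h2⟩, htot, hirr, htrans, huniq⟩ := h
  let L : LGraph 0 :=
    { V := {v : G.V // G.label v 0 = true}
      Adj := fun u w => GadReach G u w
      loopless := fun u => hirr u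
      label := fun _ i => i.elim0 }
  refine ⟨0, L, ⟨L.loopless, fun u w => ?_, fun u v w => htrans u v w⟩, ?_⟩
  · exact (htot u w u.2 w.2).imp_left Subtype.ext
  choose e2 e3 hpath using fun e : L.Edge => (e.2 : GadReach G e.1.1.1 e.1.2.1)
  let g : GadNode L → G.V := fun
    | .node1 u => u.1
    | .node2 e => e2 e
    | .node3 e => e3 e
  have hl0 : ∀ v, G.label v 0 = true → G.label v = ![true, false, false] := fun v hv => by
    have := hlab v
    funext i
    fin_cases i <;> simp_all
  have hl1 : ∀ v, G.label v 1 = true → G.label v = ![false, true, false] := fun v hv => by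
    have := hlab v
    funext i
    fin_cases i <;> simp_all
  have hl2 : ∀ v, G.label v 2 = true → G.label v = ![false, false, true] := fun v hv => by
    have := hlab v
    funext i
    fin_cases i <;> simp_all
  have hg : ∀ a, G.label (g a) = gadLabel L a := by
    rintro (u | e | e)
    · exact hl0 _ u.2
    · exact hl1 _ (hpath e).2.1
    · exact hl2 _ (hpath e).2.2.1
  have hsrc : ∀ (u : L.V) (e : L.Edge), G.Adj (e2 e) u.1 → e.1.1 = u := fun u e hue => by
    obtain ⟨p0, p1, p2, p3, a1, a2, a3⟩ := hpath e
    exact Subtype.ext ((h1 _ p1).1.unique ⟨hG _ _ a1, p0⟩ ⟨hue, u.2⟩)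
  have htgt : ∀ (u : L.V) (e : L.Edge), G.Adj (e3 e) u.1 → e.1.2 = u := fun u e hue => by
    obtain ⟨p0, p1, p2, p3, a1, a2, a3⟩ := hpath e
    exact Subtype.ext ((h2 _ p2).1.unique ⟨a3, p3⟩ ⟨hue, u.2⟩)
  -- Unique neighbours with a given label make the two chosen paths share their inner nodes, hence
  -- also their ends.
  have hmate : ∀ e f : L.Edge, G.Adj (e2 e) (e3 f) → e = f := fun e f hef => by
    obtain ⟨p0, p1, p2, p3, a1, a2, a3⟩ := hpath e
    obtain ⟨p0', p1', p2', p3', a1', a2', a3'⟩ := hpath f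
    have he3 : e3 f = e3 e := (h1 _ p1).2.unique ⟨hef, p2'⟩ ⟨a2, p2⟩
    have he2 : e2 f = e2 e := (h2 _ p2').2.unique ⟨hG _ _ a2', p1'⟩ ⟨hG _ _ hef, p1⟩
    exact Subtype.ext (Prod.ext (hsrc _ _ (he2 ▸ hG _ _ a1')) (htgt _ _ (he3 ▸ a3')))
  have hinj : Function.Injective g := by
    intro a b hab
    have hl : gadLabel L a = gadLabel L b := by rw [← hg, ← hg, hab]
    cases a <;> cases b <;> simp [gadLabel] at hl <;> congr 1
    · exact Subtype.ext hab
    · exact hmate _ _ ((show e2 _ = e2 _ from hab) ▸ (hpath _).2.2.2.2.2.1)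
    · exact hmate _ _ ((show e3 _ = e3 _ from hab) ▸ (hpath _).2.2.2.2.2.1)
  have hsurj : Function.Surjective g := by
    intro v
    have hpre : ∀ u e f w, EdgePath G u e f w → ∃ p : L.Edge, e2 p = e ∧ e3 p = f := by
      intro u e f w hp
      let p : L.Edge := ⟨(⟨u, hp.1⟩, ⟨w, hp.2.2.2.1⟩), e, f, hp⟩
      have hp2 : e2 p = e := huniq _ _ _ _ _ _ (hpath p) hp
      exact ⟨p, hp2, (h1 _ hp.2.1).2.unique ⟨hp2 ▸ (hpath p).2.2.2.2.2.1, (hpath p).2.2.1⟩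
        ⟨hp.2.2.2.2.2.1, hp.2.2.1⟩⟩
    rcases (hlab v).1 with hv | hv | hv
    · exact ⟨.node1 ⟨v, hv⟩, rfl⟩
    · obtain ⟨u, ⟨hu, hul⟩, -⟩ := (h1 v hv).1
      obtain ⟨f, ⟨hf, hfl⟩, -⟩ := (h1 v hv).2
      obtain ⟨w, ⟨hw, hwl⟩, -⟩ := (h2 f hfl).1
      obtain ⟨p, hp, -⟩ := hpre u v f w ⟨hul, hv, hfl, hwl, hG _ _ hu, hf, hw⟩
      exact ⟨.node2 p, hp⟩
    · obtain ⟨w, ⟨hw, hwl⟩, -⟩ := (h2 v hv).1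
      obtain ⟨e, ⟨he, hel⟩, -⟩ := (h2 v hv).2
      obtain ⟨u, ⟨hu, hul⟩, -⟩ := (h1 e hel).1
      obtain ⟨p, -, hp⟩ := hpre u e v w ⟨hul, hel, hv, hwl, hG _ _ hu, hG _ _ he, hw⟩
      exact ⟨.node3 p, hp⟩
  have hAdj : ∀ a b, G.Adj (g a) (g b) ↔ (gad L).Adj a b := by
    intro a b
    refine Iff.trans ?_ gad_adj_iff.symm
    have hsame : ∀ i : Fin 3, gadLabel L a i = true → gadLabel L b i = true →
        ¬ G.Adj (g a) (g b) := by
      intro i ha hb hab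
      rw [← hg] at ha hb
      have := hadj _ _ hab
      fin_cases i
      · exact this.1 ⟨ha, hb⟩
      · exact this.2.1 ⟨ha, hb⟩
      · exact this.2.2 ⟨ha, hb⟩
    have h12 : ∀ (u : L.V) (e : L.Edge), G.Adj (g (.node1 u)) (g (.node2 e)) ↔ e.1.1 = u :=
      fun u e => ⟨fun h => hsrc u e (hG _ _ h), fun h => h ▸ (hpath e).2.2.2.2.1⟩
    have h23 : ∀ e f : L.Edge, G.Adj (g (.node2 e)) (g (.node3 f)) ↔ f = e :=
      fun e f => ⟨fun h => (hmate e f h).symm, fun h => h ▸ (hpath f).2.2.2.2.2.1⟩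
    have h31 : ∀ (e : L.Edge) (u : L.V), G.Adj (g (.node3 e)) (g (.node1 u)) ↔ e.1.2 = u :=
      fun e u => ⟨fun h => htgt u e h, fun h => h ▸ (hpath e).2.2.2.2.2.2⟩
    have hsymm : G.Adj (g a) (g b) ↔ G.Adj (g b) (g a) := ⟨hG _ _, hG _ _⟩
    cases a <;> cases b <;>
      simp only [TwistStep, or_false, false_or, h12, h23, h31, Equiv.Perm.one_apply, or_self,
        iff_false]
    · exact hsame 0 rfl rfl
    · rw [hsymm, h31]
    · rw [hsymm, h12]
    · exact hsame 1 rfl rfl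
    · rw [hsymm, h23]
    · exact hsame 2 rfl rfl
  let E := Equiv.ofBijective g ⟨hinj, hsurj⟩
  have hE : ∀ v, g (E.symm v) = v := fun v => E.apply_symm_apply v
  refine ⟨E.symm, fun u v => ?_, fun v => ?_⟩
  · change _ ↔ (gad L).Adj (E.symm u) (E.symm v)
    rw [← hAdj, hE, hE]
  · change _ = gadLabel L (E.symm v)
    rw [← hg, hE]

theorem edgePath_gad_iff {L : LGraph d} {a b c e : GadNode L} : EdgePath (gad L) a b c e ↔
    ∃ p : L.Edge, a = .node1 p.1.1 ∧ b = .node2 p ∧ c = .node3 p ∧ e = .node1 p.1.2 := by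
  constructor
  · rintro ⟨l1, l2, l3, l4, h1, h2, h3⟩
    rw [gad_adj_iff] at h1 h2 h3
    cases a <;> simp [gad, gadLabel] at l1
    cases b <;> simp [gad, gadLabel] at l2
    cases c <;> simp [gad, gadLabel] at l3
    cases e <;> simp [gad, gadLabel] at l4
    simp only [TwistStep, or_false, Equiv.Perm.one_apply] at h1 h2 h3
    subst h1 h2 h3
    exact ⟨_, rfl, rfl, rfl, rfl⟩
  · rintro ⟨p, rfl, rfl, rfl, rfl⟩
    exact ⟨rfl, rfl, rfl, rfl, Or.inl (.step12 p), Or.inl (.step23 p), Or.inl (.step31 p)⟩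

theorem gadReach_gad_iff {L : LGraph d} {a b : GadNode L} : GadReach (gad L) a b ↔
    ∃ u w, a = .node1 u ∧ b = .node1 w ∧ L.Adj u w := by
  constructor
  · rintro ⟨e, f, h⟩
    obtain ⟨p, rfl, -, -, rfl⟩ := edgePath_gad_iff.1 h
    exact ⟨_, _, rfl, rfl, p.2⟩
  · rintro ⟨u, w, rfl, rfl, h⟩
    exact ⟨.node2 ⟨(u, w), h⟩, .node3 ⟨(u, w), h⟩, edgePath_gad_iff.2 ⟨⟨(u, w), h⟩, rfl, rfl, rfl, rfl⟩⟩

theorem isGadgetLike_gad (L : LGraph d) : IsGadgetLike (gad L) := by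
  refine ⟨fun v => ?_, fun v w h => ?_, fun v hv => ?_, fun v hv => ?_⟩
  · cases v <;> simp [gad, gadLabel]
  · replace h := gad_adj_iff.1 h
    cases v <;> cases w <;> simp [TwistStep] at h <;> simp [gad, gadLabel]
  · cases v with
    | node1 u => simp [gad, gadLabel] at hv
    | node3 u => simp [gad, gadLabel] at hv
    | node2 e =>
      refine ⟨⟨.node1 e.1.1, ⟨gad_adj_iff.2 (Or.inr rfl), rfl⟩, ?_⟩,
        ⟨.node3 e, ⟨gad_adj_iff.2 (Or.inl rfl), rfl⟩, ?_⟩⟩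
      all_goals
        rintro w ⟨hw, hl⟩
        replace hw := gad_adj_iff.1 hw
        cases w <;> simp [gad, gadLabel] at hl
        simp [TwistStep] at hw
        rw [hw]
  · cases v with
    | node1 u => simp [gad, gadLabel] at hv
    | node2 u => simp [gad, gadLabel] at hv
    | node3 e =>
      refine ⟨⟨.node1 e.1.2, ⟨gad_adj_iff.2 (Or.inl rfl), rfl⟩, ?_⟩,
        ⟨.node2 e, ⟨gad_adj_iff.2 (Or.inr rfl), rfl⟩, ?_⟩⟩
      all_goals
        rintro w ⟨hw, hl⟩
        replace hw := gad_adj_iff.1 hw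
        cases w <;> simp [gad, gadLabel] at hl
        simp [TwistStep] at hw
        rw [hw]

theorem isLinearGadget_gad {L : LGraph d} (hL : L.IsStrictLinearOrder) :
    IsLinearGadget (gad L) := by
  refine ⟨isGadgetLike_gad L, fun a b ha hb => ?_, fun a => ?_, fun a b c => ?_, ?_⟩
  · cases a <;> simp [gad, gadLabel] at ha
    cases b <;> simp [gad, gadLabel] at hb
    rename_i u w
    rcases hL.2.1 u w with rfl | h | h
    · exact Or.inl rfl
    · exact Or.inr (Or.inl (gadReach_gad_iff.2 ⟨u, w, rfl, rfl, h⟩))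
    · exact Or.inr (Or.inr (gadReach_gad_iff.2 ⟨w, u, rfl, rfl, h⟩))
  · intro ha
    obtain ⟨u, w, rfl, h, hadj⟩ := gadReach_gad_iff.1 ha
    injection h with h
    exact L.loopless _ (h ▸ hadj)
  · intro hab hbc
    obtain ⟨u, v, rfl, rfl, h⟩ := gadReach_gad_iff.1 hab
    obtain ⟨v', w, hv, rfl, h'⟩ := gadReach_gad_iff.1 hbc
    injection hv with hv
    subst hv
    exact gadReach_gad_iff.2 ⟨u, w, rfl, rfl, hL.2.2 _ _ _ h h'⟩
  · intro u e f w e' f' h h'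
    obtain ⟨p, rfl, rfl, rfl, rfl⟩ := edgePath_gad_iff.1 h
    obtain ⟨p', h1, rfl, rfl, h2⟩ := edgePath_gad_iff.1 h'
    injection h1 with h1
    injection h2 with h2
    rw [Subtype.ext (Prod.ext h1 h2) (a1 := p) (a2 := p')]

/-! ### Gadgetisations of linear orders are recognised by degrees -/

/-- The number of gadget paths that start at `u`. -/
noncomputable def gadDegree (G : LGraph 3) (u : G.V) : ℕ :=
  {e | G.Adj u e ∧ G.label e 1 = true}.ncard

/-- There is at most one node that starts `n` gadget paths, and if there is one, then these lead
to nodes that start `j` gadget paths, for every `j < n`. -/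
def GadDegreeAxiom (n : ℕ) (G : LGraph 3) : Prop :=
  (∀ u v, (G.label u 0 = true ∧ gadDegree G u = n) → (G.label v 0 = true ∧ gadDegree G v = n) →
    u = v) ∧
  ∀ u, (G.label u 0 = true ∧ gadDegree G u = n) → ∀ j < n,
    ∃ e, (G.Adj u e ∧ G.label e 1 = true) ∧ ∃ f, (G.Adj e f ∧ G.label f 2 = true) ∧
      ∃ w, G.Adj f w ∧ G.label w 0 = true ∧ gadDegree G w = j

/-- Pigeonhole as for out-degrees, applied to the starting nodes `e` of the paths from `u` rather
than to their ends. Injectivity on these nodes also yields uniqueness of the path between two nodes,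
which the degree axioms do not state. -/
theorem isLinearGadget_of_gadDegreeAxiom {G : LGraph 3} (h : IsGadgetLike G)
    (hdeg : ∀ n, GadDegreeAxiom n G) : IsLinearGadget G := by
  obtain ⟨hlab, hadj, h1, h2⟩ := h
  have htgt : ∀ {u u' e f f' w w'}, EdgePath G u e f w → EdgePath G u' e f' w' → w = w' := by
    intro u u' e f f' w w' p p'
    have hf : f = f' := (h1 _ p.2.1).2.unique ⟨p.2.2.2.2.2.1, p.2.2.1⟩ ⟨p'.2.2.2.2.2.1, p'.2.2.1⟩
    subst hf
    exact (h2 _ p.2.2.1).1.unique ⟨p.2.2.2.2.2.2, p.2.2.2.1⟩ ⟨p'.2.2.2.2.2.2, p'.2.2.2.1⟩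
  -- The end of a path is determined by `e`, so its degree is a function `g` of `e`; the value `0`
  -- is a dummy for nodes on no path.
  have hex : ∀ e, ∃ n, ∀ u f w, EdgePath G u e f w → gadDegree G w = n := by
    intro e
    by_cases hp : ∃ u f w, EdgePath G u e f w
    · obtain ⟨u, f, w, hp⟩ := hp
      exact ⟨gadDegree G w, fun u' f' w' hp' => by rw [htgt hp' hp]⟩
    · exact ⟨0, fun u f w hp' => absurd ⟨u, f, w, hp'⟩ hp⟩
  choose g hg using hex
  have hpath : ∀ u, G.label u 0 = true → ∀ j < gadDegree G u, ∃ e f w, EdgePath G u e f w ∧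
      gadDegree G w = j := by
    intro u hu j hj
    obtain ⟨e, ⟨he, hel⟩, f, ⟨hf, hfl⟩, w, hw, hwl, hwj⟩ := (hdeg _).2 u ⟨hu, rfl⟩ j hj
    exact ⟨e, f, w, ⟨hu, hel, hfl, hwl, he, hf, hw⟩, hwj⟩
  have hkey : ∀ u, G.label u 0 = true → (∀ e ∈ {e | G.Adj u e ∧ G.label e 1 = true},
      g e < gadDegree G u) ∧ Set.InjOn g {e | G.Adj u e ∧ G.label e 1 = true} := fun u hu =>
    lt_ncard_and_injOn_of_surjOn fun j hj => by
      obtain ⟨e, f, w, hp, hw⟩ := hpath u hu j hj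
      exact ⟨e, ⟨hp.2.2.2.2.1, hp.2.1⟩, (hg e _ _ _ hp).symm.trans hw⟩
  have hlt : ∀ {u w}, GadReach G u w → gadDegree G w < gadDegree G u := by
    rintro u w ⟨e, f, hp⟩
    rw [hg e _ _ _ hp]
    exact (hkey u hp.1).1 e ⟨hp.2.2.2.2.1, hp.2.1⟩
  have hreach : ∀ u w, G.label u 0 = true → G.label w 0 = true →
      gadDegree G w < gadDegree G u → GadReach G u w := by
    intro u w hu hw hlt
    obtain ⟨e, f, w', hp, hw'⟩ := hpath u hu _ hlt
    obtain rfl := (hdeg _).1 w' w ⟨hp.2.2.2.1, hw'⟩ ⟨hw, rfl⟩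
    exact ⟨e, f, hp⟩
  refine ⟨⟨hlab, hadj, h1, h2⟩, fun u w hu hw => ?_, fun u hu => lt_irrefl _ (hlt hu),
    fun u v w huv hvw => ?_, fun u e f w e' f' hp hp' => ?_⟩
  · rcases lt_trichotomy (gadDegree G u) (gadDegree G w) with h | h | h
    · exact Or.inr (Or.inr (hreach w u hw hu h))
    · exact Or.inl ((hdeg _).1 u w ⟨hu, h⟩ ⟨hw, rfl⟩)
    · exact Or.inr (Or.inl (hreach u w hu hw h))
  · obtain ⟨_, _, hp⟩ := id huv
    obtain ⟨_, _, hp'⟩ := id hvw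
    exact hreach u w hp.1 hp'.2.2.2.1 ((hlt hvw).trans (hlt huv))
  · refine (hkey u hp.1).2 ⟨hp.2.2.2.2.1, hp.2.1⟩ ⟨hp'.2.2.2.2.1, hp'.2.1⟩ ?_
    rw [← hg e _ _ _ hp, ← hg e' _ _ _ hp']

theorem gadDegree_node1 (L : LGraph d) (u : L.V) :
    gadDegree (gad L) (.node1 u) = L.outDegree u := by
  symm
  refine Set.ncard_congr (fun w (hw : L.Adj u w) => (.node2 ⟨(u, w), hw⟩ : GadNode L))
    (fun w hw => ⟨Or.inl (.step12 ⟨(u, w), hw⟩), rfl⟩) (fun w w' hw hw' h => ?_) fun e he => ?_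
  · injection h with h
    exact congrArg (fun p : L.Edge => p.1.2) h
  · obtain ⟨he, hl⟩ := he
    replace he := gad_adj_iff.1 he
    cases e <;> simp [gad, gadLabel] at hl
    simp only [TwistStep, or_false] at he
    subst he
    rename_i p
    exact ⟨p.1.2, p.2, rfl⟩

theorem gadDegreeAxiom_gad {L : LGraph d} (hL : L.IsStrictLinearOrder) (n : ℕ) :
    GadDegreeAxiom n (gad L) := by
  constructor
  · rintro u v ⟨hu, hun⟩ ⟨hv, hvn⟩
    cases u <;> simp [gad, gadLabel] at hu
    cases v <;> simp [gad, gadLabel] at hv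
    rw [gadDegree_node1] at hun hvn
    exact congrArg _ (hL.outDegree_injective (hun.trans hvn.symm))
  · rintro u ⟨hu, hun⟩ j hj
    cases u <;> simp [gad, gadLabel] at hu
    rw [gadDegree_node1] at hun
    obtain ⟨w, hw, hwj⟩ := hL.exists_adj_outDegree_eq (hun ▸ hj)
    let p : L.Edge := ⟨(_, w), hw⟩
    exact ⟨.node2 p, ⟨Or.inl (.step12 p), rfl⟩, .node3 p, ⟨Or.inl (.step23 p), rfl⟩, .node1 w,
      Or.inl (.step31 p), rfl, (gadDegree_node1 L w).trans hwj⟩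

/-! ### Definability of the axioms -/

theorem c2Definable_isGadgetLike :
    C2Definable fun (G : LGraph 3) _ => IsGadgetLike G := by
  have hl := fun (i : Fin 3) (z : Fin 2) => C2Definable.label (d := 3) i z
  have h1 := (((hl 0 0).or ((hl 1 0).or (hl 2 0))).and ((((hl 0 0).and (hl 1 0)).not).and
    ((((hl 0 0).and (hl 2 0)).not).and (((hl 1 0).and (hl 2 0)).not)))).forall_ 0
  have h2 := (((C2Definable.adj 0 1).imp ((((hl 0 0).and (hl 0 1)).not).and
    ((((hl 1 0).and (hl 1 1)).not).and (((hl 2 0).and (hl 2 1)).not)))).forall_ 1).forall_ 0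
  have hu := fun i : Fin 3 => ((C2Definable.adj 0 1).and (hl i 1)).existsUnique 1
  have h3 := ((hl 1 0).imp ((hu 0).and (hu 2))).forall_ 0
  have h4 := ((hl 2 0).imp ((hu 0).and (hu 1))).forall_ 0
  refine (h1.and (h2.and (h3.and h4))).congr fun G s => ?_
  simp [IsGadgetLike]

theorem C2Definable.gadDegree_eq (n : ℕ) (z : Fin 2) :
    C2Definable fun (G : LGraph 3) s => gadDegree G (s z) = n :=
  (((adj z (1 - z)).and (label 1 (1 - z))).existsExactly n (1 - z)).congr fun G s => by
    have : z ≠ 1 - z := by omega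
    simp [gadDegree, this]

/-- Two variables suffice because the walk `u, e, f, w` never refers back beyond the preceding node:
`f` reuses the variable of `u`, and `w` that of `e`. -/
theorem c2Definable_gadDegreeAxiom (n : ℕ) :
    C2Definable fun (G : LGraph 3) _ => GadDegreeAxiom n G := by
  have hl := fun (i : Fin 3) (z : Fin 2) => C2Definable.label (d := 3) i z
  have hn := fun z : Fin 2 => (hl 0 z).and (.gadDegree_eq n z)
  have h1 := (((hn 0).imp ((hn 1).imp (.eq 0 1))).forall_ 1).forall_ 0
  have hj := fun j => (((C2Definable.adj 0 1).and (hl 1 1)).and ((((C2Definable.adj 1 0).and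
    (hl 2 0)).and (((C2Definable.adj 0 1).and ((hl 0 1).and
      (.gadDegree_eq j 1))).exists_ 1)).exists_ 0)).exists_ 1
  have h2 := ((hn 0).imp (.forall_lt hj n)).forall_ 0
  refine (h1.and h2).congr fun G s => ?_
  simp [GadDegreeAxiom]

theorem FODefinable.edgePath {α : Type} (a b c e : α) :
    FODefinable fun (G : LGraph 3) (s : α → G.V) => EdgePath G (s a) (s b) (s c) (s e) :=
  (label 0 a).and ((label 1 b).and ((label 2 c).and ((label 0 e).and
    ((adj a b).and ((adj b c).and (adj c e))))))

/-- Variables `4` and `5` are bound to the inner nodes of the path, so the ends must be other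
variables. -/
theorem FODefinable.gadReach {a b : Fin 6} (ha : a < 4) (hb : b < 4) :
    FODefinable fun (G : LGraph 3) (s : Fin 6 → G.V) => GadReach G (s a) (s b) :=
  (((edgePath a 4 5 b).exists_ 5).exists_ 4).congr fun G s => by
    have h1 : a ≠ 4 := ha.ne
    have h2 : b ≠ 4 := hb.ne
    have h3 : a ≠ 5 := by omega
    have h4 : b ≠ 5 := by omega
    simp [GadReach, h1, h2, h3, h4]

theorem foDefinable_isLinearGadget :
    FODefinable fun (G : LGraph 3) (_ : Fin 6 → G.V) => IsLinearGadget G := by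
  have hl := fun z : Fin 6 => FODefinable.label (d := 3) 0 z
  have h0 := c2Definable_isGadgetLike.foDefinable.relabel (fun _ => (0 : Fin 6))
  have h1 := (((hl 0).imp ((hl 1).imp ((FODefinable.eq 0 1).or
    ((FODefinable.gadReach (a := 0) (b := 1) (by decide) (by decide)).or
      (.gadReach (a := 1) (b := 0) (by decide) (by decide)))))).forall_ 1).forall_ 0
  have h2 := (FODefinable.gadReach (a := 0) (b := 0) (by decide) (by decide)).not.forall_ 0
  have h3 := ((((FODefinable.gadReach (a := 0) (b := 1) (by decide) (by decide)).imp
    ((FODefinable.gadReach (a := 1) (b := 2) (by decide) (by decide)).imp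
      (.gadReach (a := 0) (b := 2) (by decide) (by decide)))).forall_ 2).forall_ 1).forall_ 0
  have h4 := (((((((FODefinable.edgePath (0 : Fin 6) 1 2 3).imp
    ((FODefinable.edgePath 0 4 5 3).imp (.eq 1 4))).forall_ 5).forall_ 4).forall_ 3).forall_
      2).forall_ 1).forall_ 0
  refine (h0.and (h1.and (h2.and (h3.and h4)))).congr fun G s => ?_
  simp [IsLinearGadget, Function.update]

/-- The axioms are checked on `gad L` itself and carried along the isomorphism because they are
first-order definable. -/
theorem phiGadLin_iff_isLinearGadget {G : LGraph 3} (hG : G.IsUndirected) (v : G.V) :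
    phiGadLin G v ↔ IsLinearGadget G := by
  refine ⟨?_, fun h => h.exists_isomorphic hG⟩
  rintro ⟨k, L, hL, e, hadj, hlab⟩
  exact (foDefinable_isLinearGadget.iff_of_equiv e hadj hlab fun _ => v).2 (isLinearGadget_gad hL)

theorem phiGadLin_mem_FOProperties : phiGadLin ∈ FOProperties (undirectedGraphs 3) :=
  mem_FOProperties foDefinable_isLinearGadget fun _ hG v =>
    (phiGadLin_iff_isLinearGadget hG v).symm

theorem exists_countableConj_phiGadLin :
    ∃ χ : ℕ → C2 3, InfC2Expresses (undirectedGraphs 3) (countableConj χ) phiGadLin := by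
  refine exists_countableConj (P := fun n G _ => IsGadgetLike G ∧ GadDegreeAxiom n G)
    (fun n => c2Definable_isGadgetLike.and (c2Definable_gadDegreeAxiom n)) fun G hG v => ?_
  constructor
  · exact fun h => (phiGadLin_iff_isLinearGadget hG v).2
      (isLinearGadget_of_gadDegreeAxiom (h 0).1 fun n => (h n).2)
  · rintro ⟨k, L, hL, e, hadj, hlab⟩ n
    exact ((c2Definable_isGadgetLike.and (c2Definable_gadDegreeAxiom n)).foDefinable.iff_of_equiv
      e hadj hlab fun _ => v).2 ⟨isGadgetLike_gad L, gadDegreeAxiom_gad hL n⟩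

end GraphLogic

theorem mainTheorem10 :
    -- directed graphs of any dimension
    (∀ d : ℕ,
      C2Properties (directedGraphs d) ⊂
        FOProperties (directedGraphs d) ∩ InfC2Properties (directedGraphs d) ∧
      phiLin d ∈ FOProperties (directedGraphs d) ∧
      (∃ χ : ℕ → C2 d, InfC2Expresses (directedGraphs d) (countableConj χ) (phiLin d)) ∧
      phiLin d ∉ C2Properties (directedGraphs d)) ∧
    -- undirected graphs; the witness has dimension 3
    (∀ d : ℕ,
      C2Properties (undirectedGraphs d) ⊆
        FOProperties (undirectedGraphs d) ∩ InfC2Properties (undirectedGraphs d)) ∧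
    C2Properties (undirectedGraphs 3) ⊂
      FOProperties (undirectedGraphs 3) ∩ InfC2Properties (undirectedGraphs 3) ∧
    phiGadLin ∈ FOProperties (undirectedGraphs 3) ∧
    (∃ χ : ℕ → C2 3, InfC2Expresses (undirectedGraphs 3) (countableConj χ) phiGadLin) ∧
    phiGadLin ∉ C2Properties (undirectedGraphs 3) := by
  have hdir : ∀ d, phiLin d ∈ InfC2Properties (directedGraphs d) := fun d =>
    let ⟨χ, hχ⟩ := exists_countableConj_phiLin d
    ⟨_, hχ⟩
  have hundir : phiGadLin ∈ InfC2Properties (undirectedGraphs 3) :=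
    let ⟨χ, hχ⟩ := exists_countableConj_phiGadLin
    ⟨_, hχ⟩
  refine ⟨fun d => ⟨⟨C2Properties_subset _, fun h => ?_⟩, phiLin_mem_FOProperties d,
      exists_countableConj_phiLin d, phiLin_notMem_C2Properties d⟩,
    fun d => C2Properties_subset _, ⟨C2Properties_subset _, fun h => ?_⟩,
    phiGadLin_mem_FOProperties, exists_countableConj_phiGadLin, phiGadLin_notMem_C2Properties⟩
  · exact phiLin_notMem_C2Properties d (h ⟨phiLin_mem_FOProperties d, hdir d⟩)
  · exact phiGadLin_notMem_C2Properties (h ⟨phiGadLin_mem_FOProperties, hundir⟩)
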